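/- **Model.** Let $\mathcal A,\mathcal S_e,\mathcal S,\mathcal S_d,\mathcal X$ be standard Borel spaces and $\mathcal Y,\mathcal Z,\hat{\mathcal S}$ measurable spaces (all alphabets may be uncountable). A general action-dependent integrated sensing and communication (ISAC) model consists, for every blocklength $n$, of an arbitrary conditional law $P_{S_e^nS^nS_d^n|A^n}$ of encoder side information, state and decoder side information given the action sequence, an arbitrary channel $P_{Y^nZ^n|X^nS^n}$ with output $Y^n$ and feedback $Z^n$, and a measurable distortion function $d_n:\mathcal S^n\times\hat{\mathcal S}^n\to[0,\infty)$. **Limits in probability.** For extended real random variables $Z_n$, $\text{p-}\limsup Z_n=\inf\{\alpha:\lim_n\Pr\{Z_n>\alpha\}=0\}$ and $\text{p-}\liminf Z_n=\sup\{\beta:\lim_n\Pr\{Z_n<\beta\}=0\}$. **Codes.** A code of length $n$ consists of a finite nonempty message set $\mathcal M_n$ and measurable maps: an action encoder $f_A:\mathcal M_n\to\mathcal A^n$, a message encoder $f:\mathcal M_n\times\mathcal S_e^n\to\mathcal X^n$, a decoder $h:\mathcal Y^n\times\mathcal S_d^n\to\mathcal M_n$ and a state estimator $g_n:\mathcal X^n\times\mathcal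 A^n\times\mathcal S_e^n\times\mathcal Z^n\to\hat{\mathcal S}^n$. The message $M$ is uniform on $\mathcal M_n$, $A^n=f_A(M)$, $X^n=f(M,S_e^n)$, and $P_{e,n}=\Pr\{h(Y^n,S_d^n)\ne M\}$. A pair $(R,D)$ is $m$-achievable if for every $\epsilon>0$ there is a sequence of codes with $$\liminf_{n\to\infty}\tfrac1n\log|\mathcal M_n|\ge R,\qquad \limsup_{n\to\infty}P_{e,n}\le\epsilon,\qquad \text{p-}\limsup_{n\to\infty}\tfrac1n d_n\bigl(S^n,g_n(f(M,S_e^n),f_A(M),S_e^n,Z^n)\bigr)\le D,$$ and $C_m(D)\in[-\infty,\infty]$ is the supremum of all real $R$ such that $(R,D)$ is $m$-achievable. **Information rates.** For sequences of jointly distributed random variables, $$\underline I(\boldsymbol V;\boldsymbol W)=\text{p-}\liminf_{n\to\infty}\frac1n\log\frac{dP_{V^nW^n}}{d(P_{V^n}\times P_{W^n})}(V^n,W^n),\qquad \overline I(\boldsymbol V;\boldsymbol W|\boldsymbol T)=\text{p-}\limsup_{n\to\infty}\frac1n\log\frac{dP_{T^nV^nW^n}}{d(P_{T^n}P_{V^n|T^n}P_{W^n|T^n})}(T^n,V^n,W^n),$$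 where a likelihood ratio $dP/dQ$ is taken to be $+\infty$ on the part of $P$ that is singular to $Q$. **Theorem.** For every such model and every $D\in\mathbb R$, $$C_m(D)=\sup_{\bar{\mathcal P}_D}\bigl[\underline I(\boldsymbol A,\boldsymbol U;\boldsymbol Y,\boldsymbol S_d)-\overline I(\boldsymbol U;\boldsymbol S_e|\boldsymbol A)\bigr]=\sup_{\bar{\mathcal P}_D}\bigl[\underline I(\boldsymbol U;\boldsymbol Y,\boldsymbol S_d)-\overline I(\boldsymbol U;\boldsymbol S_e|\boldsymbol A)\bigr],$$ where $\bar{\mathcal P}_D$ is the set of all processes $\{(A^n,U^n,S_e^n,S^n,S_d^n,X^n,Y^n,Z^n)\}_{n\ge1}$, with $U^n\in\mathcal U^n$ for an arbitrary standard Borel auxiliary alphabet $\mathcal U$, whose joint laws are $$P_{A^n}\,P_{S_e^nS^nS_d^n|A^n}\,P_{U^n|A^nS_e^n}\,P_{X^n|U^nS_e^n}\,P_{Y^nZ^n|X^nS^n}$$ and for which there are measurable state estimators $g_n$ with $\text{p-}\limsup_{n\to\infty}\frac1n d_n(S^n,g_n(X^n,A^n,S_e^n,Z^n))\le D$. (Here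 $\sup\emptyset=-\infty$ and $\infty-\infty$ is read as $-\infty$.) -/

import Mathlib

open MeasureTheory ProbabilityTheory Filter Topology
open scoped ENNReal NNReal

universe u

noncomputable section

namespace ISAC

/-! ### Limits in probability -/

/-- Limit superior in probability of random variables `Z n`, where `Z n` lives on the space `Ω n`
with law `P n`: the infimum of all `α` with `P n {Z n > α} → 0`. -/
def pLimsup {Ω : ℕ → Type*} [∀ n, MeasurableSpace (Ω n)] (P : ∀ n, Measure (Ω n))
    (Z : ∀ n, Ω n → EReal) : EReal :=
  sInf {α : EReal | Tendsto (fun n => P n {ω | α < Z n ω}) atTop (𝓝 0)}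

/-- Limit inferior in probability: the supremum of all `β` with `P n {Z n < β} → 0`. -/
def pLiminf {Ω : ℕ → Type*} [∀ n, MeasurableSpace (Ω n)] (P : ∀ n, Measure (Ω n))
    (Z : ∀ n, Ω n → EReal) : EReal :=
  sSup {β : EReal | Tendsto (fun n => P n {ω | Z n ω < β}) atTop (𝓝 0)}

/-! ### Spectral information rates -/

/-- The likelihood ratio `dP/dQ` of two finite measures, as a function with values in `[0, ∞]`.
It is the Radon-Nikodym derivative on the part of `P` that is absolutely continuous with respect
to `Q`, and `∞` on the part of `P` that is singular to `Q`. For laws with mass functions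
`p`, `q` it is `p / q`. -/
def likelihoodRatio {Ω : Type*} [MeasurableSpace Ω] (P Q : Measure Ω) (ω : Ω) : ℝ≥0∞ :=
  P.rnDeriv (P + Q) ω / Q.rnDeriv (P + Q) ω

/-- The normalized log-likelihood ratio `(1/n) log (dP/dQ)` (natural logarithm, values in
`[-∞, ∞]`). -/
def logRatioRate {Ω : Type*} [MeasurableSpace Ω] (n : ℕ) (P Q : Measure Ω) (ω : Ω) : EReal :=
  (((n : ℝ)⁻¹ : ℝ) : EReal) * ENNReal.log (likelihoodRatio P Q ω)

/-- Spectral inf-mutual information rate of a sequence of joint laws `P n` of pairs `(V, W)`: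
the limit inferior in probability of `(1/n) log (dP_{VW} / d(P_V × P_W))`. -/
def infMutualInfoRate {V W : ℕ → Type*} [∀ n, MeasurableSpace (V n)] [∀ n, MeasurableSpace (W n)]
    (P : ∀ n, Measure (V n × W n)) : EReal :=
  pLiminf P (fun n => logRatioRate n (P n) ((P n).fst.prod (P n).snd))

/-- The law under which `V` and `W` are conditionally independent given `T`, and `(T, V)` and
`(T, W)` are distributed as under the joint law `P` of `(T, (V, W))`: `P_T P_{V|T} P_{W|T}`. -/
def condProduct {T V W : Type*} [MeasurableSpace T] [MeasurableSpace V] [MeasurableSpace W]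
    [StandardBorelSpace V] [StandardBorelSpace W] [Nonempty V] [Nonempty W]
    (P : Measure (T × (V × W))) [IsFiniteMeasure P] : Measure (T × (V × W)) :=
  P.fst.compProd (P.condKernel.fst.prod P.condKernel.snd)

/-- Spectral sup-conditional mutual information rate of `V` and `W` given `T`, for a sequence of
joint laws `P n` of `(T, (V, W))`: the limit superior in probability of
`(1/n) log (dP_{TVW} / d(P_T P_{V|T} P_{W|T}))`. -/
def supCondMutualInfoRate {T V W : ℕ → Type*} [∀ n, MeasurableSpace (T n)]
    [∀ n, MeasurableSpace (V n)] [∀ n, MeasurableSpace (W n)]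
    [∀ n, StandardBorelSpace (V n)] [∀ n, StandardBorelSpace (W n)]
    [∀ n, Nonempty (V n)] [∀ n, Nonempty (W n)]
    (P : ∀ n, Measure (T n × (V n × W n))) [∀ n, IsFiniteMeasure (P n)] : EReal :=
  pLimsup P (fun n => logRatioRate n (P n) (condProduct (P n)))

/-! ### The model -/

/-- A general action-dependent integrated sensing and communication model with action alphabet
`A`, alphabets `Se`, `S`, `Sd` of the encoder side information, the state and the decoder side
information, input alphabet `X`, output alphabet `Y`, feedback alphabet `Z` and reconstruction
alphabet `R`. For every blocklength `n` the state law, the channel and the distortion function are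
arbitrary. -/
structure Model (A Se S Sd X Y Z R : Type u)
    [MeasurableSpace A] [MeasurableSpace Se] [MeasurableSpace S] [MeasurableSpace Sd]
    [MeasurableSpace X] [MeasurableSpace Y] [MeasurableSpace Z] [MeasurableSpace R] where
  /-- The conditional law of `(Se^n, S^n, Sd^n)` given `A^n`. -/
  state : ∀ n : ℕ, Kernel (Fin n → A) ((Fin n → Se) × (Fin n → S) × (Fin n → Sd))
  state_markov : ∀ n, IsMarkovKernel (state n)
  /-- The conditional law of `(Y^n, Z^n)` given `(X^n, S^n)`. -/
  channel : ∀ n : ℕ, Kernel ((Fin n → X) × (Fin n → S)) ((Fin n → Y) × (Fin n → Z))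
  channel_markov : ∀ n, IsMarkovKernel (channel n)
  /-- The distortion function `d_n`. -/
  dist : ∀ n : ℕ, (Fin n → S) → (Fin n → R) → ℝ≥0
  measurable_dist : ∀ n, Measurable (fun q : (Fin n → S) × (Fin n → R) => dist n q.1 q.2)

attribute [instance] Model.state_markov Model.channel_markov

section

variable {A Se S Sd X Y Z R : Type u}
  [MeasurableSpace A] [MeasurableSpace Se] [MeasurableSpace S] [MeasurableSpace Sd]
  [MeasurableSpace X] [MeasurableSpace Y] [MeasurableSpace Z] [MeasurableSpace R]

/-- A state estimator of blocklength `n`: a (measurable) map from the input, the action, the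
encoder side information and the feedback to the reconstruction. -/
structure Estimator (A Se X Z R : Type u)
    [MeasurableSpace A] [MeasurableSpace Se] [MeasurableSpace X] [MeasurableSpace Z]
    [MeasurableSpace R] (n : ℕ) where
  toFun : (Fin n → X) → (Fin n → A) → (Fin n → Se) → (Fin n → Z) → (Fin n → R)
  measurable_toFun : Measurable
    (fun q : (Fin n → X) × (Fin n → A) × (Fin n → Se) × (Fin n → Z) =>
      toFun q.1 q.2.1 q.2.2.1 q.2.2.2)

/-! ### Codes -/

/-- A code of blocklength `n` with message set `Fin numMsg`. The action set of the code is the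
range of the action encoder. -/
structure Code (A Se Sd X Y Z R : Type u)
    [MeasurableSpace A] [MeasurableSpace Se] [MeasurableSpace Sd]
    [MeasurableSpace X] [MeasurableSpace Y] [MeasurableSpace Z] [MeasurableSpace R] (n : ℕ) where
  numMsg : ℕ
  numMsg_pos : 0 < numMsg
  actionEnc : Fin numMsg → (Fin n → A)
  enc : Fin numMsg → (Fin n → Se) → (Fin n → X)
  measurable_enc : ∀ m, Measurable (enc m)
  dec : (Fin n → Y) → (Fin n → Sd) → Fin numMsg
  measurable_dec : Measurable (fun q : (Fin n → Y) × (Fin n → Sd) => dec q.1 q.2)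
  est : Estimator A Se X Z R n

namespace Code

variable {n : ℕ}

/-- The joint law of `((Se^n, S^n, Sd^n), (Y^n, Z^n))` when the message `m` is sent. -/
def lawGiven (C : Code A Se Sd X Y Z R n) (W : Model A Se S Sd X Y Z R) (m : Fin C.numMsg) :
    Measure (((Fin n → Se) × (Fin n → S) × (Fin n → Sd)) × ((Fin n → Y) × (Fin n → Z))) :=
  (W.state n (C.actionEnc m)).compProd
    ((W.channel n).comap (fun t => (C.enc m t.1, t.2.1))
      (((C.measurable_enc m).comp measurable_fst).prodMk measurable_snd.fst))

/-- The joint law of `(M, ((Se^n, S^n, Sd^n), (Y^n, Z^n)))` for a uniformly distributed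
message `M`. -/
def law (C : Code A Se Sd X Y Z R n) (W : Model A Se S Sd X Y Z R) :
    Measure (Fin C.numMsg ×
      (((Fin n → Se) × (Fin n → S) × (Fin n → Sd)) × ((Fin n → Y) × (Fin n → Z)))) :=
  (C.numMsg : ℝ≥0∞)⁻¹ • ∑ m, (Measure.dirac m).prod (C.lawGiven W m)

/-- The average decoding error probability. -/
def errorProb (C : Code A Se Sd X Y Z R n) (W : Model A Se S Sd X Y Z R) : ℝ≥0∞ :=
  C.law W {ω | C.dec ω.2.2.1 ω.2.1.2.2 ≠ ω.1}

/-- The normalized distortion `(1/n) d_n(S^n, g_n(f(M, Se^n), f_A(M), Se^n, Z^n))`. -/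
def distortion (C : Code A Se Sd X Y Z R n) (W : Model A Se S Sd X Y Z R)
    (ω : Fin C.numMsg ×
      (((Fin n → Se) × (Fin n → S) × (Fin n → Sd)) × ((Fin n → Y) × (Fin n → Z)))) : EReal :=
  (((W.dist n ω.2.1.2.1
    (C.est.toFun (C.enc ω.1 ω.2.1.1) (C.actionEnc ω.1) ω.2.1.1 ω.2.2.2) : ℝ) / n : ℝ) : EReal)

end Code

/-- `(r, D)` is achievable under the maximal distortion criterion. -/
def Model.Achievable (W : Model A Se S Sd X Y Z R) (r D : ℝ) : Prop :=
  ∀ ε : ℝ, 0 < ε → ∃ C : ∀ n : ℕ, Code A Se Sd X Y Z R n,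
    (r : EReal) ≤ liminf (fun n : ℕ => ((Real.log (C n).numMsg / n : ℝ) : EReal)) atTop ∧
    limsup (fun n : ℕ => (C n).errorProb W) atTop ≤ ENNReal.ofReal ε ∧
    pLimsup (fun n => (C n).law W) (fun n => (C n).distortion W) ≤ (D : EReal)

/-- The capacity-distortion function `C_m(D)` under the maximal distortion criterion. It is `-∞`
if no code sequence meets the distortion constraint. -/
def Model.capacity (W : Model A Se S Sd X Y Z R) (D : ℝ) : EReal :=
  sSup {v : EReal | ∃ r : ℝ, W.Achievable r D ∧ v = (r : EReal)}

/-! ### Processes -/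

/-- The free factors `P_{A^n}`, `P_{U^n|A^n Se^n}`, `P_{X^n|U^n Se^n}`, `n = 0, 1, 2, ...`, of a
process `(A, U, Se, S, Sd, X, Y, Z)` for a model with auxiliary alphabet `U`. -/
structure GenProcess (A Se X U : Type u) [MeasurableSpace A] [MeasurableSpace Se]
    [MeasurableSpace X] [MeasurableSpace U] where
  action : ∀ n : ℕ, Measure (Fin n → A)
  action_prob : ∀ n, IsProbabilityMeasure (action n)
  aux : ∀ n : ℕ, Kernel ((Fin n → A) × (Fin n → Se)) (Fin n → U)
  aux_markov : ∀ n, IsMarkovKernel (aux n)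
  input : ∀ n : ℕ, Kernel ((Fin n → U) × (Fin n → Se)) (Fin n → X)
  input_markov : ∀ n, IsMarkovKernel (input n)

attribute [instance] GenProcess.action_prob GenProcess.aux_markov GenProcess.input_markov

namespace GenProcess

variable {U : Type u} [MeasurableSpace U]

/-- The joint law `P_{A^n} P_{Se^n S^n Sd^n|A^n} P_{U^n|A^n Se^n} P_{X^n|U^n Se^n}
P_{Y^n Z^n|X^n S^n}` of `((((A^n, (Se^n, S^n, Sd^n)), U^n), X^n), (Y^n, Z^n))`. -/
def law (p : GenProcess A Se X U) (W : Model A Se S Sd X Y Z R) (n : ℕ) :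
    Measure (((((Fin n → A) × ((Fin n → Se) × (Fin n → S) × (Fin n → Sd))) × (Fin n → U)) ×
      (Fin n → X)) × ((Fin n → Y) × (Fin n → Z))) :=
  ((((p.action n).compProd (W.state n)).compProd
    ((p.aux n).comap (fun t => (t.1, t.2.1))
      (measurable_fst.prodMk measurable_snd.fst))).compProd
    ((p.input n).comap (fun t => (t.2, t.1.2.1))
      (measurable_snd.prodMk measurable_fst.snd.fst))).compProd
    ((W.channel n).comap (fun t => (t.2, t.1.1.2.2.1))
      (measurable_snd.prodMk measurable_fst.fst.snd.snd.fst))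

instance (p : GenProcess A Se X U) (W : Model A Se S Sd X Y Z R) (n : ℕ) :
    IsProbabilityMeasure (p.law W n) := by
  unfold law; infer_instance

/-- `I(A, U; Y, Sd)`, spectral inf-mutual information rate. -/
def infInfoAU (p : GenProcess A Se X U) (W : Model A Se S Sd X Y Z R) : EReal :=
  infMutualInfoRate (fun n => (p.law W n).map
    (fun ω => ((ω.1.1.1.1, ω.1.1.2), (ω.2.1, ω.1.1.1.2.2.2))))

/-- `I(U; Y, Sd)`, spectral inf-mutual information rate. -/
def infInfoU (p : GenProcess A Se X U) (W : Model A Se S Sd X Y Z R) : EReal :=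
  infMutualInfoRate (fun n => (p.law W n).map
    (fun ω => (ω.1.1.2, (ω.2.1, ω.1.1.1.2.2.2))))

/-- `I(U; Se | A)`, spectral sup-conditional mutual information rate. -/
def supInfoCond [StandardBorelSpace U] [Nonempty U] [StandardBorelSpace Se] [Nonempty Se]
    (p : GenProcess A Se X U) (W : Model A Se S Sd X Y Z R) : EReal :=
  supCondMutualInfoRate (fun n => (p.law W n).map
    (fun ω => (ω.1.1.1.1, (ω.1.1.2, ω.1.1.1.2.1))))

/-- The maximal distortion constraint: for some state estimators `g_n`, the limit superior in
probability of `(1/n) d_n(S^n, g_n(X^n, A^n, Se^n, Z^n))` is at most `D`. -/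
def MeetsDistortion (p : GenProcess A Se X U) (W : Model A Se S Sd X Y Z R) (D : ℝ) : Prop :=
  ∃ g : ∀ n : ℕ, Estimator A Se X Z R n,
    pLimsup (fun n => p.law W n) (fun n ω =>
      (((W.dist n ω.1.1.1.2.2.1
        ((g n).toFun ω.1.2 ω.1.1.1.1 ω.1.1.1.2.1 ω.2.2) : ℝ) / n : ℝ) : EReal)) ≤ (D : EReal)

end GenProcess

/-- The supremum of `I(A, U; Y, Sd) - I(U; Se | A)` over all standard Borel auxiliary alphabets and
all processes that meet the distortion constraint. (In `EReal`, `∞ - ∞ = -∞`, so a process for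
which both rates are infinite does not contribute.) -/
def Model.supWithAction [StandardBorelSpace Se] [Nonempty Se]
    (W : Model A Se S Sd X Y Z R) (D : ℝ) : EReal :=
  sSup {v : EReal | ∃ (U : Type u) (_ : MeasurableSpace U) (_ : StandardBorelSpace U)
    (_ : Nonempty U) (p : GenProcess A Se X U),
    p.MeetsDistortion W D ∧ v = p.infInfoAU W - p.supInfoCond W}

/-- The supremum of `I(U; Y, Sd) - I(U; Se | A)` over the same processes. -/
def Model.supWithoutAction [StandardBorelSpace Se] [Nonempty Se]
    (W : Model A Se S Sd X Y Z R) (D : ℝ) : EReal :=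
  sSup {v : EReal | ∃ (U : Type u) (_ : MeasurableSpace U) (_ : StandardBorelSpace U)
    (_ : Nonempty U) (p : GenProcess A Se X U),
    p.MeetsDistortion W D ∧ v = p.infInfoU W - p.supInfoCond W}

end

end ISAC

end

/-!
The capacity is compared with the two suprema by a direct part and a converse, both reduced to
statements about a single blocklength.

*Likelihood ratios.* Two facts about `dP/dQ` carry all estimates. On the part of
a set where it is at most `t`, the measure `P` is at most `t` times the `Q`-measure of the set
(`measure_inter_likelihoodRatio_le`), and its `Q`-integral over a set is at most the `P`-measure of
the set (`setLIntegral_likelihoodRatio_le`).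
No absolute continuity is needed, since the singular part of `P` sits where the ratio is infinite.

*Direct part.* Codewords are drawn at random: an action `a` from `P_A`, then `L` auxiliary words
from `P_{U|A=a}`. The encoder observes `s` and looks for a word `u` such that `(a, s, u)` is in a
set `G`, on which the density of `P_{U|A,Se}` with respect to `P_{U|A}` is at most `K` and the
conditional probability of a bad event `B` given `(a, s, u)` is at most `δ`. The bad event combines
excess distortion with the failure of the decoding test. The search fails with probability at most
`P(Gᶜ) + exp (-L / K)` (`lintegral_pow_compl_le`), where the condition on `B` costs `P(B) / δ` by
Markov's inequality; once it succeeds, `B` has probability at most `δ` whatever the law of the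
chosen word is. This is what makes the distortion constraint hold in probability for the code. Input
randomness and auxiliary words are realised as measurable functions of uniform variables, so that
`exists_oneShot_code` can fix all of them at once by averaging.

The law of the channel output under the code is not controlled by the one under the process, so the
decoding set has to have small sections over *every* output value. The sections are small for almost
every output under the process, and the exceptional outputs are simply removed from the set
(`exists_decodingSet`). With `exp (n r)` messages, `L ≈ exp (n b)`, `K = exp (n c)`,
`I(U; Se | A) < c < b` and decoding threshold `exp (n a)` with `r + b < a`, all terms vanish, which
gives `GenProcess.achievable`. A decoding set that ignores the action yields the formula with
`I(U; Y, Sd)` in the same way.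

*Converse.* A diagonal argument turns codes with arbitrarily small errors into a code sequence with
vanishing error. Taking the message itself, repeated `n` times, as auxiliary word makes `U` and `Se`
conditionally independent given `A`, so the conditional rate is at most zero, while `U` determines
the message, so that `measure_likelihoodRatio_le_of_decoder` bounds both information rates below by
the rate of the code (`Model.Achievable.exists_process`).
-/

noncomputable section

namespace ISAC

/-! ### Limits in probability -/

section Limits

variable {Ω : ℕ → Type*} [∀ n, MeasurableSpace (Ω n)] {P : ∀ n, Measure (Ω n)}
  {Z : ∀ n, Ω n → EReal}

lemma tendsto_measure_of_pLimsup_lt {α : EReal} (h : pLimsup P Z < α) :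
    Tendsto (fun n => P n {ω | α < Z n ω}) atTop (𝓝 0) := by
  obtain ⟨β, hβ, hβα⟩ := sInf_lt_iff.1 h
  exact tendsto_of_tendsto_of_tendsto_of_le_of_le tendsto_const_nhds hβ (fun _ => zero_le)
    fun n => measure_mono fun ω hω => hβα.trans hω

lemma tendsto_measure_of_lt_pLiminf {β : EReal} (h : β < pLiminf P Z) :
    Tendsto (fun n => P n {ω | Z n ω < β}) atTop (𝓝 0) := by
  obtain ⟨α, hα, hβα⟩ := lt_sSup_iff.1 h
  exact tendsto_of_tendsto_of_tendsto_of_le_of_le tendsto_const_nhds hα (fun _ => zero_le)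
    fun n => measure_mono fun ω hω => lt_trans hω hβα

lemma pLimsup_le_of_forall {D : ℝ}
    (h : ∀ α : ℝ, D < α → Tendsto (fun n => P n {ω | (α : EReal) < Z n ω}) atTop (𝓝 0)) :
    pLimsup P Z ≤ D := by
  refine le_of_forall_gt fun c hc => ?_
  obtain ⟨α, hα, hαc⟩ := EReal.lt_iff_exists_real_btwn.1 hc
  exact (sInf_le (h α (EReal.coe_lt_coe_iff.1 hα))).trans_lt hαc

lemma le_pLiminf_of_forall {r : ℝ}
    (h : ∀ β : ℝ, β < r → Tendsto (fun n => P n {ω | Z n ω < (β : EReal)}) atTop (𝓝 0)) :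
    (r : EReal) ≤ pLiminf P Z := by
  refine le_of_forall_lt fun c hc => ?_
  obtain ⟨α, hα, hαc⟩ := EReal.lt_iff_exists_real_btwn.1 hc
  exact hα.trans_le (le_sSup (h α (EReal.coe_lt_coe_iff.1 hαc)))

end Limits

/-- Diagonal choice of a parameter: if each of countably many properties holds eventually, then
there is a parameter `k n` tending to infinity such that the `k n`-th one eventually holds at
`n`. -/
lemma exists_tendsto_eventually_of_forall_eventually {Q : ℕ → ℕ → Prop}
    (h : ∀ k, ∀ᶠ n in atTop, Q k n) :
    ∃ k : ℕ → ℕ, Tendsto k atTop atTop ∧ ∀ᶠ n in atTop, Q (k n) n := by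
  classical
  refine ⟨fun n => Nat.findGreatest (fun k => ∀ m, n ≤ m → Q k m) n, ?_, ?_⟩
  · refine tendsto_atTop.2 fun K => ?_
    obtain ⟨N, hN⟩ := eventually_atTop.1 (h K)
    filter_upwards [eventually_ge_atTop N, eventually_ge_atTop K] with n hn hK
    exact Nat.le_findGreatest hK fun m hm => hN m (hn.trans hm)
  · obtain ⟨N, hN⟩ := eventually_atTop.1 (h 0)
    filter_upwards [eventually_ge_atTop N] with n hn
    exact Nat.findGreatest_spec (P := fun k => ∀ m, n ≤ m → Q k m) (Nat.zero_le n)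
      (fun m hm => hN m (hn.trans hm)) n le_rfl

/-! ### Likelihood ratios -/

section LikelihoodRatio

variable {Ω : Type*} [MeasurableSpace Ω]

@[fun_prop]
lemma measurable_likelihoodRatio (P Q : Measure Ω) : Measurable (likelihoodRatio P Q) :=
  (Measure.measurable_rnDeriv _ _).div (Measure.measurable_rnDeriv _ _)

/-- Change of measure from `P` to `Q` on a set where the likelihood ratio is bounded. -/
lemma measure_inter_likelihoodRatio_le (P Q : Measure Ω) [IsFiniteMeasure P] [IsFiniteMeasure Q]
    {t : ℝ≥0∞} (ht : t ≠ ∞) {E : Set Ω} (hE : MeasurableSet E) :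
    P (E ∩ {ω | likelihoodRatio P Q ω ≤ t}) ≤ t * Q E := by
  have hP : P ≪ P + Q := Measure.absolutelyContinuous_of_le (Measure.le_add_right le_rfl)
  have hQ : Q ≪ P + Q := Measure.absolutelyContinuous_of_le (Measure.le_add_left le_rfl)
  have hF : MeasurableSet (E ∩ {ω | likelihoodRatio P Q ω ≤ t}) :=
    hE.inter (measurableSet_le (measurable_likelihoodRatio P Q) measurable_const)
  calc P (E ∩ {ω | likelihoodRatio P Q ω ≤ t})
      = ∫⁻ ω in E ∩ {ω | likelihoodRatio P Q ω ≤ t}, P.rnDeriv (P + Q) ω ∂(P + Q) :=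
        (Measure.setLIntegral_rnDeriv hP _).symm
    _ ≤ ∫⁻ ω in E ∩ {ω | likelihoodRatio P Q ω ≤ t}, t * Q.rnDeriv (P + Q) ω ∂(P + Q) := by
        refine setLIntegral_mono_ae ((Measure.measurable_rnDeriv _ _).const_mul t).aemeasurable ?_
        filter_upwards [Q.rnDeriv_ne_top (P + Q)] with ω hω h
        exact (ENNReal.div_le_iff_le_mul (Or.inr ht) (Or.inl hω)).1 h.2
    _ = t * Q (E ∩ {ω | likelihoodRatio P Q ω ≤ t}) := by
        rw [lintegral_const_mul _ (Measure.measurable_rnDeriv _ _),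
          Measure.setLIntegral_rnDeriv hQ]
    _ ≤ t * Q E := by gcongr; exact Set.inter_subset_left

lemma measure_likelihoodRatio_le (P Q : Measure Ω) [IsFiniteMeasure P] [IsProbabilityMeasure Q]
    {t : ℝ≥0∞} (ht : t ≠ ∞) : P {ω | likelihoodRatio P Q ω ≤ t} ≤ t := by
  simpa using measure_inter_likelihoodRatio_le P Q ht MeasurableSet.univ

lemma setLIntegral_likelihoodRatio_le (P Q : Measure Ω) [IsFiniteMeasure P] [IsFiniteMeasure Q]
    {E : Set Ω} (hE : MeasurableSet E) : ∫⁻ ω in E, likelihoodRatio P Q ω ∂Q ≤ P E := by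
  have hP : P ≪ P + Q := Measure.absolutelyContinuous_of_le (Measure.le_add_right le_rfl)
  have hQ : Q ≪ P + Q := Measure.absolutelyContinuous_of_le (Measure.le_add_left le_rfl)
  calc ∫⁻ ω in E, likelihoodRatio P Q ω ∂Q
      = ∫⁻ ω in E, Q.rnDeriv (P + Q) ω * likelihoodRatio P Q ω ∂(P + Q) :=
        (setLIntegral_rnDeriv_mul hQ (measurable_likelihoodRatio P Q).aemeasurable hE).symm
    _ ≤ ∫⁻ ω in E, P.rnDeriv (P + Q) ω ∂(P + Q) := by
        refine lintegral_mono fun ω => ?_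
        exact ENNReal.mul_div_le
    _ = P E := Measure.setLIntegral_rnDeriv hP _

lemma likelihoodRatio_self (P : Measure Ω) [IsFiniteMeasure P] :
    ∀ᵐ ω ∂P, likelihoodRatio P P ω = 1 := by
  have hP : P ≪ P + P := Measure.absolutelyContinuous_of_le (Measure.le_add_right le_rfl)
  filter_upwards [Measure.rnDeriv_pos hP, hP (P.rnDeriv_ne_top (P + P))] with ω h0 h1
  exact ENNReal.div_self h0.ne' h1

lemma logRatioRate_le_iff {n : ℕ} (hn : 0 < n) (P Q : Measure Ω) (ω : Ω) (c : ℝ) :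
    logRatioRate n P Q ω ≤ c ↔
      likelihoodRatio P Q ω ≤ ENNReal.ofReal (Real.exp (n * c)) := by
  have hn' : (0 : ℝ) < n := by exact_mod_cast hn
  have h1 : ENNReal.log (ENNReal.ofReal (Real.exp (n * c))) = ((n * c : ℝ) : EReal) := by
    rw [ENNReal.log_ofReal_of_pos (Real.exp_pos _), Real.log_exp]
  rw [← ENNReal.log_le_log_iff, h1, logRatioRate]
  induction ENNReal.log (likelihoodRatio P Q ω) with
  | bot => rw [EReal.coe_mul_bot_of_pos (inv_pos.2 hn')]; simp
  | top =>
    rw [EReal.coe_mul_top_of_pos (inv_pos.2 hn')]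
    simp only [top_le_iff, EReal.coe_ne_top]
  | coe x =>
    rw [← EReal.coe_mul, EReal.coe_le_coe_iff, EReal.coe_le_coe_iff, inv_mul_le_iff₀ hn']

lemma logRatioRate_lt_iff {n : ℕ} (hn : 0 < n) (P Q : Measure Ω) (ω : Ω) (c : ℝ) :
    logRatioRate n P Q ω < c ↔
      likelihoodRatio P Q ω < ENNReal.ofReal (Real.exp (n * c)) := by
  have hn' : (0 : ℝ) < n := by exact_mod_cast hn
  have h1 : ENNReal.log (ENNReal.ofReal (Real.exp (n * c))) = ((n * c : ℝ) : EReal) := by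
    rw [ENNReal.log_ofReal_of_pos (Real.exp_pos _), Real.log_exp]
  rw [← ENNReal.log_lt_log_iff, h1, logRatioRate]
  induction ENNReal.log (likelihoodRatio P Q ω) with
  | bot =>
    rw [EReal.coe_mul_bot_of_pos (inv_pos.2 hn')]
    simp only [EReal.bot_lt_coe]
  | top => rw [EReal.coe_mul_top_of_pos (inv_pos.2 hn')]; simp
  | coe x =>
    rw [← EReal.coe_mul, EReal.coe_lt_coe_iff, EReal.coe_lt_coe_iff, inv_mul_lt_iff₀ hn']

lemma lt_logRatioRate_iff {n : ℕ} (hn : 0 < n) (P Q : Measure Ω) (ω : Ω) (c : ℝ) :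
    (c : EReal) < logRatioRate n P Q ω ↔
      ENNReal.ofReal (Real.exp (n * c)) < likelihoodRatio P Q ω := by
  rw [← not_le, logRatioRate_le_iff hn, not_le]

end LikelihoodRatio

lemma tendsto_exp_nat_mul_atTop_nhds_zero {c : ℝ} (hc : c < 0) :
    Tendsto (fun n : ℕ => ENNReal.ofReal (Real.exp (n * c))) atTop (𝓝 0) := by
  rw [← ENNReal.ofReal_zero]
  refine ENNReal.tendsto_ofReal (Real.tendsto_exp_atBot.comp ?_)
  exact (tendsto_natCast_atTop_atTop (R := ℝ)).atTop_mul_const_of_neg hc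

/-- A spectral information rate against a probability measure is nonnegative, since a likelihood
ratio `dP/dQ` is at most `t` with `P`-probability at most `t`. -/
lemma zero_le_pLimsup_logRatioRate {Ω : ℕ → Type*} [∀ n, MeasurableSpace (Ω n)]
    (P Q : ∀ n, Measure (Ω n)) [∀ n, IsProbabilityMeasure (P n)]
    [∀ n, IsProbabilityMeasure (Q n)] :
    0 ≤ pLimsup P (fun n => logRatioRate n (P n) (Q n)) := by
  by_contra! h
  obtain ⟨c, hc, hc0⟩ := EReal.lt_iff_exists_real_btwn.1 h
  have hc0 : c < 0 := by exact_mod_cast hc0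
  have h1 := (tendsto_measure_of_pLimsup_lt hc).add (tendsto_exp_nat_mul_atTop_nhds_zero hc0)
  rw [add_zero] at h1
  have h2 : ∀ᶠ n : ℕ in atTop, (1 : ℝ≥0∞) ≤ P n {ω | (c : EReal) < logRatioRate n (P n) (Q n) ω} +
      ENNReal.ofReal (Real.exp (n * c)) := by
    filter_upwards [eventually_gt_atTop 0] with n hn
    calc (1 : ℝ≥0∞) = P n Set.univ := measure_univ.symm
      _ ≤ P n ({ω | (c : EReal) < logRatioRate n (P n) (Q n) ω} ∪
          {ω | likelihoodRatio (P n) (Q n) ω ≤ ENNReal.ofReal (Real.exp (n * c))}) := by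
        refine measure_mono fun ω _ => ?_
        rw [Set.mem_union, Set.mem_ofPred_eq, lt_logRatioRate_iff hn]
        exact lt_or_ge _ _
      _ ≤ _ := (measure_union_le _ _).trans
        (add_le_add_right (measure_likelihoodRatio_le _ _ ENNReal.ofReal_ne_top) _)
  exact absurd (ge_of_tendsto h1 h2) (by simp)

/-- The decoding set for a joint law `P` of `(V, W)`: it has a small section over *every* value of
`W`, with no reference to the law of `W`, and it misses little more of `P` than the event that the
likelihood ratio is below the threshold `t`. -/
lemma exists_decodingSet {V W : Type*} [MeasurableSpace V] [MeasurableSpace W]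
    (P : Measure (V × W)) [IsProbabilityMeasure P] {t : ℝ≥0∞} (ht : t ≠ 0) (ht' : t ≠ ∞) :
    ∃ T : Set (V × W), MeasurableSet T ∧ (∀ w, P.fst {v | (v, w) ∈ T} ≤ t⁻¹) ∧
      P Tᶜ ≤ P {ω | likelihoodRatio P (P.fst.prod P.snd) ω < t} := by
  set Q := P.fst.prod P.snd
  have hm := measurable_likelihoodRatio P Q
  -- The marginal of `(dP/dQ) • Q` on `W` is at most `P.snd`, so the integral over `V` is at most
  -- one almost surely; the remaining values of `W` are removed.
  let J : W → ℝ≥0∞ := fun w => ∫⁻ v, likelihoodRatio P Q (v, w) ∂P.fst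
  have hJ : Measurable J := hm.lintegral_prod_left'
  have hJ1 : ∀ᵐ w ∂P.snd, J w ≤ 1 := by
    refine ae_le_of_forall_setLIntegral_le_of_sigmaFinite hJ fun F hF _ => ?_
    calc ∫⁻ w in F, J w ∂P.snd
        = ∫⁻ ω, likelihoodRatio P Q ω ∂(P.fst.prod (P.snd.restrict F)) :=
          (lintegral_prod_symm' _ hm).symm
      _ = ∫⁻ ω in Set.univ ×ˢ F, likelihoodRatio P Q ω ∂Q := by
          rw [← Measure.prod_restrict, Measure.restrict_univ]
      _ ≤ P (Set.univ ×ˢ F) :=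
          setLIntegral_likelihoodRatio_le P Q (MeasurableSet.univ.prod hF)
      _ = ∫⁻ _ in F, 1 ∂P.snd := by
          rw [setLIntegral_one, Measure.snd_apply hF, Set.univ_prod]
  refine ⟨{ω | t ≤ likelihoodRatio P Q ω} ∩ {ω | J ω.2 ≤ 1},
    (measurableSet_le measurable_const hm).inter
      (measurableSet_le (hJ.comp measurable_snd) measurable_const), fun w => ?_, ?_⟩
  · by_cases hw : J w ≤ 1
    · calc P.fst {v | (v, w) ∈ {ω | t ≤ likelihoodRatio P Q ω} ∩ {ω | J ω.2 ≤ 1}}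
          ≤ P.fst {v | t ≤ likelihoodRatio P Q (v, w)} := measure_mono fun v hv => hv.1
        _ ≤ J w / t :=
          meas_ge_le_lintegral_div (hm.comp measurable_prodMk_right).aemeasurable ht ht'
        _ ≤ t⁻¹ := by rw [div_eq_mul_inv]; exact mul_le_of_le_one_left' hw
    · simp [hw]
  · have h0 : P {ω | ¬ J ω.2 ≤ 1} = 0 := by
      have hms : MeasurableSet {w | ¬ J w ≤ 1} := (measurableSet_le hJ measurable_const).compl
      rw [ae_iff, Measure.snd_apply hms] at hJ1
      exact hJ1
    calc P ({ω | t ≤ likelihoodRatio P Q ω} ∩ {ω | J ω.2 ≤ 1})ᶜ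
        ≤ P ({ω | likelihoodRatio P Q ω < t} ∪ {ω | ¬ J ω.2 ≤ 1}) := by
          refine measure_mono fun ω hω => ?_
          simpa only [Set.mem_compl_iff, Set.mem_inter_iff, Set.mem_ofPred_eq, Set.mem_union,
            not_and_or, not_le] using hω
      _ ≤ _ := (measure_union_le _ _).trans (by rw [h0, add_zero])

/-! ### Covering by random words -/

lemma exists_measurable_selector {X ι : Type*} [MeasurableSpace X] [Finite ι] [Nonempty ι]
    [MeasurableSpace ι] (E : ι → Set X) (hE : ∀ i, MeasurableSet (E i)) :
    ∃ s : X → ι, Measurable s ∧ ∀ x i, x ∈ E i → x ∈ E (s x) := by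
  classical
  have := Fintype.ofFinite ι
  suffices h : ∀ F : Finset ι, ∃ s : X → ι, Measurable s ∧ ∀ x, ∀ i ∈ F, x ∈ E i → x ∈ E (s x) by
    obtain ⟨s, hs, h⟩ := h Finset.univ
    exact ⟨s, hs, fun x i => h x i (Finset.mem_univ i)⟩
  intro F
  induction F using Finset.induction_on with
  | empty => exact ⟨fun _ => Classical.arbitrary ι, measurable_const, by simp⟩
  | insert i F _ ih =>
    obtain ⟨s, hs, h⟩ := ih
    refine ⟨fun x => if x ∈ E i then i else s x, Measurable.ite (hE i) measurable_const hs,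
      fun x j hj hx => ?_⟩
    by_cases hxi : x ∈ E i
    · simp [hxi]
    · obtain rfl | hj := Finset.mem_insert.1 hj
      · exact absurd hx hxi
      · simpa [hxi] using h x j hj hx

/-- The elementary inequality behind the covering lemma: `L` independent trials of success
probability `p ≥ q / K` all fail with probability at most `1 - q + exp (-L / K)`. -/
lemma one_sub_pow_le {p q K : ℝ} (hp1 : p ≤ 1) (hq0 : 0 ≤ q) (hq1 : q ≤ 1)
    (hK : 0 < K) (h : q ≤ K * p) (L : ℕ) :
    (1 - p) ^ L ≤ (1 - q) + Real.exp (-(L / K)) := by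
  have h1 : (1 - p) ^ L ≤ Real.exp (-(q * (L / K))) := by
    calc (1 - p) ^ L ≤ (Real.exp (-p)) ^ L :=
          pow_le_pow_left₀ (by linarith) (Real.one_sub_le_exp_neg p) L
      _ = Real.exp (-(p * L)) := by rw [← Real.exp_nat_mul]; congr 1; ring
      _ ≤ Real.exp (-(q * (L / K))) := by
          apply Real.exp_le_exp.2
          have : q / K ≤ p := by rw [div_le_iff₀ hK]; linarith
          have h2 : q / K * L ≤ p * L := by gcongr
          have h3 : q * (L / K) = q / K * L := by ring
          linarith
  -- Convexity of the exponential between `0` and `-L / K`.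
  have h2 := convexOn_exp.2 (Set.mem_univ 0) (Set.mem_univ (-((L : ℝ) / K)))
    (sub_nonneg.2 hq1) hq0 (by ring)
  simp only [smul_eq_mul, mul_zero, zero_add, Real.exp_zero, mul_one] at h2
  have h3 : q * Real.exp (-(L / K)) ≤ Real.exp (-(L / K)) :=
    mul_le_of_le_one_left (Real.exp_pos _).le hq1
  have h4 : -(q * ((L : ℝ) / K)) = q * -(L / K) := by ring
  rw [h4] at h1
  linarith

section Covering

variable {α σ υ : Type*} [MeasurableSpace α] [MeasurableSpace σ] [MeasurableSpace υ]

/-- Covering lemma: `L` independent draws from `auxA a` all miss `G` with small probability if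
`aux (a, s)` restricted to `G` has density at most `K` with respect to `auxA a`. -/
lemma lintegral_pow_compl_le (m : Measure (α × σ)) [IsProbabilityMeasure m]
    (aux : Kernel (α × σ) υ) [IsMarkovKernel aux] (auxA : Kernel α υ) [IsMarkovKernel auxA]
    {K : ℝ} (hK : 0 < K) {G : Set ((α × σ) × υ)} (hG : MeasurableSet G)
    (h : ∀ F, MeasurableSet F → (m ⊗ₘ aux) (F ∩ G) ≤
      ENNReal.ofReal K * (m ⊗ₘ Kernel.prodMkRight σ auxA) F) (L : ℕ) :
    ∫⁻ z, (auxA z.1 {u | (z, u) ∉ G}) ^ L ∂m ≤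
      (m ⊗ₘ aux) Gᶜ + ENNReal.ofReal (Real.exp (-(L / K))) := by
  let q : α × σ → ℝ≥0∞ := fun z => aux z (Prod.mk z ⁻¹' G)
  let p : α × σ → ℝ≥0∞ := fun z => Kernel.prodMkRight σ auxA z (Prod.mk z ⁻¹' G)
  have hq : Measurable q := Kernel.measurable_kernel_prodMk_left hG
  have hp : Measurable p := Kernel.measurable_kernel_prodMk_left hG
  have hqp : ∀ᵐ z ∂m, q z ≤ ENNReal.ofReal K * p z := by
    refine ae_le_of_forall_setLIntegral_le_of_sigmaFinite hq fun F hF _ => ?_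
    have hFG : MeasurableSet ((Prod.fst ⁻¹' F) ∩ G : Set ((α × σ) × υ)) :=
      (measurable_fst hF).inter hG
    have key : ∀ (η : Kernel (α × σ) υ) [IsMarkovKernel η],
        (m ⊗ₘ η) ((Prod.fst ⁻¹' F) ∩ G) = ∫⁻ z in F, η z (Prod.mk z ⁻¹' G) ∂m := by
      intro η _
      rw [Measure.compProd_apply hFG, ← lintegral_indicator hF]
      refine lintegral_congr fun z => ?_
      by_cases hz : z ∈ F <;> simp [hz, Set.preimage_inter, Set.preimage_preimage]
    rw [lintegral_const_mul _ hp, ← key aux, ← key (Kernel.prodMkRight σ auxA)]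
    simpa [Set.inter_assoc] using h _ hFG
  calc ∫⁻ z, (auxA z.1 {u | (z, u) ∉ G}) ^ L ∂m
      ≤ ∫⁻ z, (aux z (Prod.mk z ⁻¹' Gᶜ) + ENNReal.ofReal (Real.exp (-(L / K)))) ∂m := by
        refine lintegral_mono_ae ?_
        filter_upwards [hqp] with z hz
        have hGz : MeasurableSet (Prod.mk z ⁻¹' G) := measurable_prodMk_left hG
        have e1 : auxA z.1 {u | (z, u) ∉ G} = ENNReal.ofReal (1 - (p z).toReal) := by
          change auxA z.1 (Prod.mk z ⁻¹' G)ᶜ = _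
          rw [prob_compl_eq_one_sub hGz, ENNReal.ofReal_sub _ ENNReal.toReal_nonneg,
            ENNReal.ofReal_one, ENNReal.ofReal_toReal (measure_ne_top _ _)]
          rfl
        have e2 : aux z (Prod.mk z ⁻¹' Gᶜ) = ENNReal.ofReal (1 - (q z).toReal) := by
          rw [Set.preimage_compl, prob_compl_eq_one_sub hGz,
            ENNReal.ofReal_sub _ ENNReal.toReal_nonneg,
            ENNReal.ofReal_one, ENNReal.ofReal_toReal (measure_ne_top _ _)]
        have hp1 : (p z).toReal ≤ 1 := ENNReal.toReal_le_of_le_ofReal zero_le_one (by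
          rw [ENNReal.ofReal_one]; exact prob_le_one)
        have hq1 : (q z).toReal ≤ 1 := ENNReal.toReal_le_of_le_ofReal zero_le_one (by
          rw [ENNReal.ofReal_one]; exact prob_le_one)
        have hqp' : (q z).toReal ≤ K * (p z).toReal := by
          have := ENNReal.toReal_mono
            (ENNReal.mul_ne_top ENNReal.ofReal_ne_top (measure_ne_top _ _)) hz
          rwa [ENNReal.toReal_mul, ENNReal.toReal_ofReal hK.le] at this
        rw [e1, e2, ← ENNReal.ofReal_pow (sub_nonneg.2 hp1),
          ← ENNReal.ofReal_add (sub_nonneg.2 hq1) (Real.exp_pos _).le]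
        exact ENNReal.ofReal_le_ofReal
          (one_sub_pow_le hp1 ENNReal.toReal_nonneg hq1 hK hqp' L)
    _ = _ := by
        rw [lintegral_add_right _ measurable_const, Measure.compProd_apply hG.compl]
        simp

end Covering

/-! ### One-shot joint laws -/

section Words

variable {α σ τ υ χ ω β : Type*} [MeasurableSpace α] [MeasurableSpace σ] [MeasurableSpace τ]
  [MeasurableSpace υ] [MeasurableSpace χ] [MeasurableSpace ω] [MeasurableSpace β]

/-- The joint law of `((s, t), o)` when the action `a` is taken and the channel input is `f s`:
`s` is the side information of the encoder, `t` the rest of the state and `o` the output. -/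
def wordLaw (κ : Kernel α (σ × τ)) (ch : Kernel (χ × τ) ω) (a : α) (f : σ → χ)
    (hf : Measurable f) : Measure ((σ × τ) × ω) :=
  κ a ⊗ₘ ch.comap (fun z => (f z.1, z.2)) ((hf.comp measurable_fst).prodMk measurable_snd)

instance (κ : Kernel α (σ × τ)) [IsMarkovKernel κ] (ch : Kernel (χ × τ) ω) [IsMarkovKernel ch]
    (a : α) (f : σ → χ) (hf : Measurable f) : IsProbabilityMeasure (wordLaw κ ch a f hf) := by
  unfold wordLaw; infer_instance

/-- The joint law of `((((a, (s, t)), u), x), o)` in a single use of the model: action, state,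
auxiliary word given `(a, s)`, channel input given `(u, s)` and output given `(x, t)`. -/
def jointLaw (μ : Measure α) (κ : Kernel α (σ × τ)) (aux : Kernel (α × σ) υ)
    (inp : Kernel (υ × σ) χ) (ch : Kernel (χ × τ) ω) :
    Measure ((((α × (σ × τ)) × υ) × χ) × ω) :=
  (((μ ⊗ₘ κ) ⊗ₘ aux.comap (fun z => (z.1, z.2.1))
      (measurable_fst.prodMk measurable_snd.fst)) ⊗ₘ
    inp.comap (fun z => (z.2, z.1.2.1)) (measurable_snd.prodMk measurable_fst.snd.fst)) ⊗ₘ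
    ch.comap (fun z => (z.2, z.1.1.2.2)) (measurable_snd.prodMk measurable_fst.fst.snd.snd)

variable (μ : Measure α) [IsProbabilityMeasure μ] (κ : Kernel α (σ × τ)) [IsMarkovKernel κ]
  (aux : Kernel (α × σ) υ) [IsMarkovKernel aux] (inp : Kernel (υ × σ) χ) [IsMarkovKernel inp]
  (ch : Kernel (χ × τ) ω) [IsMarkovKernel ch]

lemma lintegral_jointLaw {f : ((((α × (σ × τ)) × υ) × χ) × ω) → ℝ≥0∞} (hf : Measurable f) :
    ∫⁻ z, f z ∂jointLaw μ κ aux inp ch =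
      ∫⁻ a, ∫⁻ y, ∫⁻ u, ∫⁻ x, ∫⁻ o, f ((((a, y), u), x), o) ∂ch (x, y.2) ∂inp (u, y.1)
        ∂aux (a, y.1) ∂κ a ∂μ := by
  unfold jointLaw
  rw [Measure.lintegral_compProd hf, Measure.lintegral_compProd (by fun_prop),
    Measure.lintegral_compProd (by fun_prop), Measure.lintegral_compProd (by fun_prop)]
  rfl

/-- The conditional probability of the event `B` given `((a, s), u)`. It is written with kernels, so
that it is meaningful for every `u`, also for one that is not drawn from `aux (a, s)`. -/
def condBad [Nonempty τ] [StandardBorelSpace τ] [MeasurableSpace.CountableOrCountablyGenerated α σ]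
    (B : Set ((((α × (σ × τ)) × υ) × χ) × ω)) (z : (α × σ) × υ) : ℝ≥0∞ :=
  ∫⁻ t, ∫⁻ x, ch (x, t) {o | ((((z.1.1, (z.1.2, t)), z.2), x), o) ∈ B} ∂inp (z.2, z.1.2)
    ∂κ.condKernel z.1

variable [Nonempty τ] [StandardBorelSpace τ] [MeasurableSpace.CountableOrCountablyGenerated α σ]

lemma measurable_condBad {B : Set ((((α × (σ × τ)) × υ) × χ) × ω)} (hB : MeasurableSet B) :
    Measurable (condBad κ inp ch B) := by
  have h1 : Measurable (fun y : (((α × σ) × υ) × τ) × χ =>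
      ch (y.2, y.1.2) {o | ((((y.1.1.1.1, (y.1.1.1.2, y.1.2)), y.1.1.2), y.2), o) ∈ B}) :=
    Kernel.measurable_kernel_prodMk_left
      (κ := ch.comap (fun y : (((α × σ) × υ) × τ) × χ => (y.2, y.1.2)) (by fun_prop))
      (t := (fun y : ((((α × σ) × υ) × τ) × χ) × ω =>
        ((((y.1.1.1.1.1, (y.1.1.1.1.2, y.1.1.2)), y.1.1.1.2), y.1.2), y.2)) ⁻¹' B)
      ((by fun_prop : Measurable _) hB)
  have h2 := h1.lintegral_kernel_prod_right'
    (κ := inp.comap (fun y : ((α × σ) × υ) × τ => (y.1.2, y.1.1.2)) (by fun_prop))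
  exact h2.lintegral_kernel_prod_right'
    (κ := κ.condKernel.comap (fun z : (α × σ) × υ => z.1) measurable_fst)

/-- Integration against `κ a`, with the second component drawn after the first one. -/
lemma lintegral_eq_lintegral_condKernel {f : σ × τ → ℝ≥0∞} (hf : Measurable f) (a : α) :
    ∫⁻ y, f y ∂κ a = ∫⁻ s, ∫⁻ t, f (s, t) ∂κ.condKernel (a, s) ∂κ.fst a := by
  conv_lhs => rw [← κ.disintegrate κ.condKernel]
  exact Kernel.lintegral_compProd _ _ _ hf

lemma lintegral_condBad {B : Set ((((α × (σ × τ)) × υ) × χ) × ω)} (hB : MeasurableSet B) :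
    ∫⁻ z, condBad κ inp ch B z ∂((μ ⊗ₘ κ.fst) ⊗ₘ aux) = jointLaw μ κ aux inp ch B := by
  have hm := measurable_condBad κ inp ch hB
  have h1 : Measurable (fun y : ((α × (σ × τ)) × υ) × χ =>
      ch (y.2, y.1.1.2.2) {o | (y, o) ∈ B}) :=
    Kernel.measurable_kernel_prodMk_left
      (κ := ch.comap (fun y : ((α × (σ × τ)) × υ) × χ => (y.2, y.1.1.2.2)) (by fun_prop)) hB
  have h2 : Measurable (fun y : (α × (σ × τ)) × υ => ∫⁻ x, ch (x, y.1.2.2)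
      {o | ((y, x), o) ∈ B} ∂inp (y.2, y.1.2.1)) :=
    h1.lintegral_kernel_prod_right'
      (κ := inp.comap (fun y : (α × (σ × τ)) × υ => (y.2, y.1.2.1)) (by fun_prop))
  have h3 : Measurable (fun y : α × (σ × τ) => ∫⁻ u, ∫⁻ x, ch (x, y.2.2)
      {o | (((y, u), x), o) ∈ B} ∂inp (u, y.2.1) ∂aux (y.1, y.2.1)) :=
    h2.lintegral_kernel_prod_right'
      (κ := aux.comap (fun y : α × (σ × τ) => (y.1, y.2.1)) (by fun_prop))
  rw [← lintegral_indicator_one hB, lintegral_jointLaw _ _ _ _ _ (measurable_one.indicator hB),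
    Measure.lintegral_compProd hm, Measure.lintegral_compProd (by fun_prop)]
  refine lintegral_congr fun a => ?_
  have e : ∀ (y : σ × τ) (u : υ) (x : χ), ∫⁻ o, B.indicator 1 ((((a, y), u), x), o) ∂ch (x, y.2) =
      ch (x, y.2) {o | ((((a, y), u), x), o) ∈ B} := fun y u x =>
    lintegral_indicator_one (measurable_prodMk_left hB)
  simp_rw [e]
  refine Eq.trans ?_
    (lintegral_eq_lintegral_condKernel κ (h3.comp measurable_prodMk_left) a).symm
  refine lintegral_congr fun s => ?_
  exact lintegral_lintegral_swap (μ := aux (a, s)) (ν := κ.condKernel (a, s))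
    (h2.comp (by fun_prop : Measurable fun z : υ × τ => ((a, (s, z.2)), z.1))).aemeasurable

end Words

/-! ### Random codewords -/

section RandomCoding

variable {α : Type u} {σ τ υ χ ω β : Type*} [MeasurableSpace α] [MeasurableSpace σ]
  [MeasurableSpace τ] [MeasurableSpace υ] [MeasurableSpace χ] [MeasurableSpace ω]
  [MeasurableSpace β]

/-- The law of `((s, t), o)` for a codeword indexed by `q`, as a kernel in `q`. -/
def wordKernel {Q : Type*} [MeasurableSpace Q] (κ : Kernel α (σ × τ)) (ch : Kernel (χ × τ) ω)
    (a : Q → α) (ha : Measurable a) (f : Q × σ → χ) (hf : Measurable f) :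
    Kernel Q ((σ × τ) × ω) :=
  κ.comap a ha ⊗ₖ ch.comap (fun z : Q × (σ × τ) => (f (z.1, z.2.1), z.2.2))
    ((hf.comp (measurable_fst.prodMk measurable_snd.fst)).prodMk measurable_snd.snd)

instance {Q : Type*} [MeasurableSpace Q] (κ : Kernel α (σ × τ)) [IsMarkovKernel κ]
    (ch : Kernel (χ × τ) ω) [IsMarkovKernel ch]
    (a : Q → α) (ha : Measurable a) (f : Q × σ → χ) (hf : Measurable f) :
    IsMarkovKernel (wordKernel κ ch a ha f hf) := by
  unfold wordKernel; infer_instance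

lemma wordKernel_apply {Q : Type*} [MeasurableSpace Q] (κ : Kernel α (σ × τ)) [IsMarkovKernel κ]
    (ch : Kernel (χ × τ) ω) [IsMarkovKernel ch]
    (a : Q → α) (ha : Measurable a) (f : Q × σ → χ) (hf : Measurable f) (q : Q) :
    wordKernel κ ch a ha f hf q =
      wordLaw κ ch (a q) (fun s => f (q, s)) (hf.comp measurable_prodMk_left) := by
  unfold wordKernel wordLaw
  rw [Kernel.compProd_apply_eq_compProd_sectR]
  rfl

lemma wordKernel_preimage_fst_fst {Q : Type*} [MeasurableSpace Q] (κ : Kernel α (σ × τ))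
    [IsMarkovKernel κ] (ch : Kernel (χ × τ) ω) [IsMarkovKernel ch]
    (a : Q → α) (ha : Measurable a) (f : Q × σ → χ) (hf : Measurable f) (q : Q)
    {S : Set σ} (hS : MeasurableSet S) :
    wordKernel κ ch a ha f hf q {y | y.1.1 ∈ S} = κ.fst (a q) S := by
  have h := Kernel.fst_compProd (κ.comap a ha)
    (ch.comap (fun z : Q × (σ × τ) => (f (z.1, z.2.1), z.2.2))
    ((hf.comp (measurable_fst.prodMk measurable_snd.fst)).prodMk measurable_snd.snd))
  rw [Kernel.fst_apply' _ _ hS]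
  exact (Kernel.fst_apply' _ _ (measurable_fst hS)).symm.trans
    (by rw [wordKernel, h]; rfl)

lemma map_prod_eq_compProd (μ : Measure α) [IsProbabilityMeasure μ] (η : Kernel α υ)
    [IsMarkovKernel η] {ν : α → unitInterval → υ} (hν : Measurable (Function.uncurry ν))
    (hνη : ∀ a, (volume : Measure unitInterval).map (ν a) = η a) :
    (μ.prod volume).map (fun z : α × unitInterval => (z.1, ν z.1 z.2)) = μ ⊗ₘ η := by
  have hm : Measurable (fun z : α × unitInterval => (z.1, ν z.1 z.2)) := measurable_fst.prodMk hν
  ext S hS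
  rw [Measure.map_apply hm hS, Measure.prod_apply (hm hS), Measure.compProd_apply hS]
  refine lintegral_congr fun a => ?_
  rw [← hνη a, Measure.map_apply hν.of_uncurry_left (measurable_prodMk_left hS)]
  rfl

variable (μ : Measure α) [IsProbabilityMeasure μ] (κ : Kernel α (σ × τ)) [IsMarkovKernel κ]
  (aux : Kernel (α × σ) υ) [IsMarkovKernel aux] (inp : Kernel (υ × σ) χ) [IsMarkovKernel inp]
  (ch : Kernel (χ × τ) ω) [IsMarkovKernel ch] (auxA : Kernel α υ) [IsMarkovKernel auxA]

/-- An action and the randomness from which `L` auxiliary words are generated. A further element of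
the unit interval provides the randomness of the channel input. -/
abbrev WordSeed (α : Type*) (L : ℕ) := α × (Fin L → unitInterval)

/-- A random codeword: an action `a q` together with `L` auxiliary words `u l q`, drawn from
`auxA (a q)`, and an encoder `f (q, ·)` of the side information. The encoder looks for an auxiliary
word such that `((a, s), u)` lies in a set `G` on which the density of `aux` with respect to `auxA`
is bounded by `K` and on which the conditional probability of the event `B` is small. Up to the
event `Err`, `B` does not occur for some auxiliary word of the codeword. -/
lemma exists_random_codeword [Nonempty τ] [StandardBorelSpace τ] [Nonempty υ]
    [StandardBorelSpace υ] [Nonempty χ] [StandardBorelSpace χ]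
    [MeasurableSpace.CountableOrCountablyGenerated α σ]
    {G₀ : Set ((α × σ) × υ)} (hG₀ : MeasurableSet G₀) {K : ℝ} (hK : 0 < K)
    (hdens : ∀ F, MeasurableSet F → ((μ ⊗ₘ κ.fst) ⊗ₘ aux) (F ∩ G₀) ≤
      ENNReal.ofReal K * ((μ ⊗ₘ κ.fst) ⊗ₘ Kernel.prodMkRight σ auxA) F)
    {B : Set ((((α × (σ × τ)) × υ) × χ) × ω)} (hB : MeasurableSet B)
    {δ : ℝ≥0∞} (hδ : δ ≠ 0) (hδ' : δ ≠ ∞) (L : ℕ) [NeZero L] :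
    ∃ (Q : Type u) (_ : MeasurableSpace Q) (ρ : Measure Q) (_ : IsProbabilityMeasure ρ)
      (a : Q → α) (ha : Measurable a) (u : Fin L → Q → υ) (_ : ∀ l, Measurable (u l))
      (f : Q × σ → χ) (hf : Measurable f) (Err : Set (Q × ((σ × τ) × ω))),
      MeasurableSet Err ∧
      (∀ l, ρ.map (fun q => (a q, u l q)) = μ ⊗ₘ auxA) ∧
      (∀ q y, (q, y) ∉ Err → ∃ l, ((((a q, y.1), u l q), f (q, y.1.1)), y.2) ∉ B) ∧
      (ρ ⊗ₘ wordKernel κ ch a ha f hf) Err ≤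
        ((μ ⊗ₘ κ.fst) ⊗ₘ aux) G₀ᶜ + jointLaw μ κ aux inp ch B / δ +
          ENNReal.ofReal (Real.exp (-(L / K))) + δ := by
  obtain ⟨ν, hν, hνA⟩ := auxA.exists_measurable_map_eq_unitInterval
  obtain ⟨ψ, hψ, hψi⟩ := inp.exists_measurable_map_eq_unitInterval
  have hcb := measurable_condBad κ inp ch hB
  let G : Set ((α × σ) × υ) := G₀ ∩ {z | condBad κ inp ch B z < δ}
  have hG : MeasurableSet G := hG₀.inter (measurableSet_lt hcb measurable_const)
  let u : Fin L → WordSeed α L → υ := fun l r => ν r.1 (r.2 l)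
  have hu : ∀ l, Measurable (u l) := fun l => hν.comp
    (by fun_prop : Measurable fun r : WordSeed α L => (r.1, r.2 l))
  obtain ⟨sel, hsel, hselE⟩ := exists_measurable_selector (X := WordSeed α L × σ) (ι := Fin L)
    (fun l => {z | ((z.1.1, z.2), u l z.1) ∈ G})
    (fun l => (by fun_prop : Measurable fun z : WordSeed α L × σ => ((z.1.1, z.2), u l z.1)) hG)
  let us : WordSeed α L × σ → υ := fun z => u (sel z) z.1
  have hus : Measurable us := by
    have h : Measurable (fun z : Fin L × WordSeed α L => u z.1 z.2) :=
      measurable_from_prod_countable_right fun l => hu l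
    exact h.comp (hsel.prodMk measurable_fst)
  let f : (WordSeed α L × unitInterval) × σ → χ := fun z => ψ (us (z.1.1, z.2), z.2) z.1.2
  have hf : Measurable f := hψ.comp (by fun_prop : Measurable
    fun z : (WordSeed α L × unitInterval) × σ => ((us (z.1.1, z.2), z.2), z.1.2))
  let a : WordSeed α L × unitInterval → α := fun q => q.1.1
  have ha : Measurable a := by fun_prop
  let E₁ : Set ((WordSeed α L × unitInterval) × ((σ × τ) × ω)) :=
    {z | ((z.1.1.1, z.2.1.1), us (z.1.1, z.2.1.1)) ∉ G}
  let E₂ : Set ((WordSeed α L × unitInterval) × ((σ × τ) × ω)) :=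
    {z | ((z.1.1.1, z.2.1.1), us (z.1.1, z.2.1.1)) ∈ G ∧
      ((((z.1.1.1, z.2.1), us (z.1.1, z.2.1.1)), f (z.1, z.2.1.1)), z.2.2) ∈ B}
  have hE₁ : MeasurableSet E₁ := (by fun_prop : Measurable
    fun z : (WordSeed α L × unitInterval) × ((σ × τ) × ω) =>
      ((z.1.1.1, z.2.1.1), us (z.1.1, z.2.1.1))) hG.compl
  have hE₂ : MeasurableSet E₂ := MeasurableSet.inter
    ((by fun_prop : Measurable fun z : (WordSeed α L × unitInterval) × ((σ × τ) × ω) =>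
      ((z.1.1.1, z.2.1.1), us (z.1.1, z.2.1.1))) hG)
    ((by fun_prop : Measurable fun z : (WordSeed α L × unitInterval) × ((σ × τ) × ω) =>
      ((((z.1.1.1, z.2.1), us (z.1.1, z.2.1.1)), f (z.1, z.2.1.1)), z.2.2)) hB)
  let ρR : Measure (WordSeed α L) := μ.prod (Measure.pi fun _ => volume)
  refine ⟨WordSeed α L × unitInterval, inferInstance, ρR.prod volume, inferInstance, a, ha,
    fun l q => u l q.1, fun l => (hu l).comp measurable_fst, f, hf, E₁ ∪ E₂, hE₁.union hE₂,
    fun l => ?_, fun q y hy => ⟨sel (q.1, y.1.1), fun hyB => ?_⟩, ?_⟩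
  · have h := (((MeasurePreserving.id μ).prod
      (measurePreserving_eval (fun _ : Fin L => (volume : Measure unitInterval)) l)).comp
      (measurePreserving_fst (μ := ρR) (ν := (volume : Measure unitInterval))))
    have hm : Measurable (fun z : α × unitInterval => (z.1, ν z.1 z.2)) :=
      measurable_fst.prodMk hν
    rw [← map_prod_eq_compProd μ auxA hν hνA, ← h.map_eq, Measure.map_map hm h.measurable]
    rfl
  · by_cases h : ((q.1.1, y.1.1), us (q.1, y.1.1)) ∈ G
    · exact hy (Or.inr ⟨h, hyB⟩)
    · exact hy (Or.inl h)
  · -- The encoder finds no auxiliary word in `G`.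
    have h₁ : (ρR.prod volume ⊗ₘ wordKernel κ ch a ha f hf) E₁ ≤
        ((μ ⊗ₘ κ.fst) ⊗ₘ aux) G₀ᶜ + jointLaw μ κ aux inp ch B / δ +
          ENNReal.ofReal (Real.exp (-(L / K))) := by
      let C : Set (WordSeed α L × σ) := {z | ∀ l, ((z.1.1, z.2), u l z.1) ∉ G}
      have hC : MeasurableSet C := by
        have : C = ⋂ l, {z | ((z.1.1, z.2), u l z.1) ∉ G} := by ext z; simp [C]
        rw [this]
        exact MeasurableSet.iInter fun l =>
          (by fun_prop : Measurable fun z : WordSeed α L × σ => ((z.1.1, z.2), u l z.1)) hG.compl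
      have hsub : E₁ ⊆ {z | (z.1.1, z.2.1.1) ∈ C} := fun z hz l hl =>
        hz (hselE (z.1.1, z.2.1.1) l hl)
      have hCm : MeasurableSet
          {z : (WordSeed α L × unitInterval) × ((σ × τ) × ω) | (z.1.1, z.2.1.1) ∈ C} :=
        (by fun_prop : Measurable
          fun z : (WordSeed α L × unitInterval) × ((σ × τ) × ω) => (z.1.1, z.2.1.1)) hC
      have hκC : Measurable fun r : WordSeed α L => κ.fst r.1 (Prod.mk r ⁻¹' C) :=
        Kernel.measurable_kernel_prodMk_left
          (κ := κ.fst.comap (fun r : WordSeed α L => r.1) measurable_fst) hC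
      have hprod : ∀ z : α × σ, (Measure.pi fun _ : Fin L => (volume : Measure unitInterval))
          {ξ | ((z.1, ξ), z.2) ∈ C} = (auxA z.1 {w | (z, w) ∉ G}) ^ L := fun z => by
        have hGz : MeasurableSet {w | (z, w) ∉ G} := measurable_prodMk_left hG.compl
        have : {ξ : Fin L → unitInterval | ((z.1, ξ), z.2) ∈ C} =
            Set.pi Set.univ fun _ => ν z.1 ⁻¹' {w | (z, w) ∉ G} := by
          ext ξ; simp [C, u]
        rw [this, Measure.pi_pi, Finset.prod_const, ← hνA, Finset.card_univ, Fintype.card_fin,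
          Measure.map_apply hν.of_uncurry_left hGz]
      have hpm : Measurable fun z : α × σ => (auxA z.1 {w | (z, w) ∉ G}) ^ L :=
        (Kernel.measurable_kernel_prodMk_left (κ := Kernel.prodMkRight σ auxA) hG.compl).pow_const L
      calc (ρR.prod volume ⊗ₘ wordKernel κ ch a ha f hf) E₁
          ≤ (ρR.prod volume ⊗ₘ wordKernel κ ch a ha f hf) {z | (z.1.1, z.2.1.1) ∈ C} :=
            measure_mono hsub
        _ = ∫⁻ q, κ.fst q.1.1 (Prod.mk q.1 ⁻¹' C) ∂(ρR.prod (volume : Measure unitInterval)) := by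
            rw [Measure.compProd_apply hCm]
            exact lintegral_congr fun q =>
              wordKernel_preimage_fst_fst κ ch a ha f hf q (S := Prod.mk q.1 ⁻¹' C)
                (measurable_prodMk_left hC)
        _ = ∫⁻ r, κ.fst r.1 (Prod.mk r ⁻¹' C) ∂ρR :=
            measurePreserving_fst.lintegral_comp hκC
        _ = ∫⁻ b, ∫⁻ ξ, κ.fst b (Prod.mk (b, ξ) ⁻¹' C) ∂(Measure.pi fun _ => volume) ∂μ :=
            lintegral_prod _ hκC.aemeasurable
        _ = ∫⁻ b, ∫⁻ s, (auxA b {w | ((b, s), w) ∉ G}) ^ L ∂κ.fst b ∂μ := by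
            refine lintegral_congr fun b => ?_
            have hCb : MeasurableSet {y : (Fin L → unitInterval) × σ | ((b, y.1), y.2) ∈ C} :=
              (by fun_prop : Measurable
                fun y : (Fin L → unitInterval) × σ => ((b, y.1), y.2)) hC
            exact ((Measure.prod_apply hCb).symm.trans (Measure.prod_apply_symm hCb)).trans
              (lintegral_congr fun s => hprod (b, s))
        _ = ∫⁻ z, (auxA z.1 {w | (z, w) ∉ G}) ^ L ∂(μ ⊗ₘ κ.fst) :=
            (Measure.lintegral_compProd hpm).symm
        _ ≤ ((μ ⊗ₘ κ.fst) ⊗ₘ aux) Gᶜ + ENNReal.ofReal (Real.exp (-(L / K))) :=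
            lintegral_pow_compl_le _ aux auxA hK hG (fun F hF => (measure_mono
              (Set.inter_subset_inter_right F Set.inter_subset_left)).trans (hdens F hF)) L
        _ ≤ _ := by
            gcongr
            calc ((μ ⊗ₘ κ.fst) ⊗ₘ aux) Gᶜ
                ≤ ((μ ⊗ₘ κ.fst) ⊗ₘ aux) (G₀ᶜ ∪ {z | δ ≤ condBad κ inp ch B z}) := by
                  refine measure_mono fun z hz => ?_
                  simpa only [G, Set.mem_compl_iff, Set.mem_inter_iff, Set.mem_ofPred_eq,
                    Set.mem_union, not_and_or, not_lt] using hz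
              _ ≤ _ := (measure_union_le _ _).trans (by
                  gcongr
                  exact (meas_ge_le_lintegral_div hcb.aemeasurable hδ hδ').trans_eq
                    (by rw [lintegral_condBad μ κ aux inp ch hB]))
    -- The encoder finds one, and `B` occurs nevertheless.
    have h₂ : (ρR.prod volume ⊗ₘ wordKernel κ ch a ha f hf) E₂ ≤ δ := by
      have hΛ := Kernel.measurable_kernel_prodMk_left (κ := wordKernel κ ch a ha f hf) hE₂
      let g : unitInterval → WordSeed α L → σ × τ → ℝ≥0∞ := fun θ r y =>
        ch (f ((r, θ), y.1), y.2) {o | ((r, θ), (y, o)) ∈ E₂}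
      have hg : Measurable fun z : (unitInterval × WordSeed α L) × (σ × τ) => g z.1.1 z.1.2 z.2 :=
        Kernel.measurable_kernel_prodMk_left
          (κ := ch.comap (fun z : (unitInterval × WordSeed α L) × (σ × τ) =>
            (f ((z.1.2, z.1.1), z.2.1), z.2.2)) (by fun_prop))
          (t := (fun z : ((unitInterval × WordSeed α L) × (σ × τ)) × ω =>
            ((z.1.1.2, z.1.1.1), (z.1.2, z.2))) ⁻¹' E₂)
          ((by fun_prop : Measurable _) hE₂)
      rw [Measure.compProd_apply hE₂, lintegral_prod _ hΛ.aemeasurable]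
      refine (lintegral_mono (g := fun _ => δ) fun r => ?_).trans_eq (by simp)
      have hgr : Measurable fun z : unitInterval × (σ × τ) => g z.1 r z.2 :=
        hg.comp (by fun_prop : Measurable
          fun z : unitInterval × (σ × τ) => ((z.1, r), z.2))
      calc ∫⁻ θ, wordKernel κ ch a ha f hf (r, θ) (Prod.mk (r, θ) ⁻¹' E₂)
          = ∫⁻ θ, ∫⁻ y, g θ r y ∂κ r.1 := lintegral_congr fun θ =>
            Kernel.compProd_apply (measurable_prodMk_left hE₂) _ _ _
        _ = ∫⁻ y, ∫⁻ θ, g θ r y ∂volume ∂κ r.1 := lintegral_lintegral_swap hgr.aemeasurable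
        _ = ∫⁻ s, ∫⁻ t, ∫⁻ θ, g θ r (s, t) ∂volume ∂κ.condKernel (r.1, s) ∂κ.fst r.1 :=
            lintegral_eq_lintegral_condKernel κ hgr.lintegral_prod_left' r.1
        _ ≤ ∫⁻ _, δ ∂κ.fst r.1 := by
            refine lintegral_mono fun s => ?_
            by_cases hs : ((r.1, s), us (r, s)) ∈ G
            · refine le_trans (le_of_eq ?_) hs.2.le
              refine lintegral_congr fun t => ?_
              have hB' : Measurable fun x : χ => ch (x, t)
                  {o | ((((r.1, (s, t)), us (r, s)), x), o) ∈ B} :=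
                Kernel.measurable_kernel_prodMk_left
                  (κ := ch.comap (fun x : χ => (x, t)) (by fun_prop))
                  (t := (fun z : χ × ω => ((((r.1, (s, t)), us (r, s)), z.1), z.2)) ⁻¹' B)
                  ((by fun_prop : Measurable _) hB)
              rw [← hψi, lintegral_map hB' hψ.of_uncurry_left]
              refine lintegral_congr fun θ => ?_
              simp only [g, E₂, Set.mem_ofPred_eq, hs, true_and]
              rfl
            · simp [g, E₂, hs]
        _ = δ := by simp
    exact (measure_union_le _ _).trans (add_le_add h₁ h₂)

end RandomCoding

/-! ### A one-shot coding theorem -/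

section Packing

variable {α : Type u} {σ τ υ χ ω β : Type*} [MeasurableSpace α] [MeasurableSpace σ]
  [MeasurableSpace τ] [MeasurableSpace υ] [MeasurableSpace χ] [MeasurableSpace ω]
  [MeasurableSpace β]

variable (μ : Measure α) [IsProbabilityMeasure μ] (κ : Kernel α (σ × τ)) [IsMarkovKernel κ]
  (aux : Kernel (α × σ) υ) [IsMarkovKernel aux] (inp : Kernel (υ × σ) χ) [IsMarkovKernel inp]
  (ch : Kernel (χ × τ) ω) [IsMarkovKernel ch] (auxA : Kernel α υ) [IsMarkovKernel auxA]

lemma map_pi_eval_pair {ι Q : Type*} [Fintype ι] [MeasurableSpace Q] (ρ : Measure Q)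
    [IsProbabilityMeasure ρ] {i j : ι} (hij : i ≠ j) :
    (Measure.pi fun _ : ι => ρ).map (fun c => (c i, c j)) = ρ.prod ρ := by
  have h := (iIndepFun_pi (μ := fun _ : ι => ρ) (X := fun _ => id)
    (fun _ => aemeasurable_id)).indepFun hij
  have h2 := (indepFun_iff_map_prod_eq_prod_map_map (measurable_pi_apply i).aemeasurable
    (measurable_pi_apply j).aemeasurable).1 h
  refine h2.trans ?_
  change ((Measure.pi fun _ : ι => ρ).map (Function.eval i)).prod
    ((Measure.pi fun _ : ι => ρ).map (Function.eval j)) = _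
  rw [(measurePreserving_eval (fun _ : ι => ρ) i).map_eq,
    (measurePreserving_eval (fun _ : ι => ρ) j).map_eq]

/-- One-shot coding theorem. The decoder sees `v y` and uses the decoding set `T` of pairs `(a, u)`
and `w`, every section of which has probability at most `t`; the event `E` (excess distortion) is
to be avoided together with decoding errors. Both are controlled by the event `B`. -/
theorem exists_oneShot_code [Nonempty τ] [StandardBorelSpace τ] [Nonempty υ]
    [StandardBorelSpace υ] [Nonempty χ] [StandardBorelSpace χ]
    [MeasurableSpace.CountableOrCountablyGenerated α σ]
    {G₀ : Set ((α × σ) × υ)} (hG₀ : MeasurableSet G₀) {K : ℝ} (hK : 0 < K)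
    (hdens : ∀ F, MeasurableSet F → ((μ ⊗ₘ κ.fst) ⊗ₘ aux) (F ∩ G₀) ≤
      ENNReal.ofReal K * ((μ ⊗ₘ κ.fst) ⊗ₘ Kernel.prodMkRight σ auxA) F)
    {B : Set ((((α × (σ × τ)) × υ) × χ) × ω)} (hB : MeasurableSet B)
    {v : (σ × τ) × ω → β} (hv : Measurable v)
    {T : Set ((α × υ) × β)} (hT : MeasurableSet T) {t : ℝ≥0∞}
    (hTt : ∀ w, (μ ⊗ₘ auxA) {z | (z, w) ∈ T} ≤ t)
    {E : Set (((α × (σ × τ)) × χ) × ω)}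
    (hBTE : ∀ a y u x o, ((((a, y), u), x), o) ∉ B →
      ((a, u), v (y, o)) ∈ T ∧ (((a, y), x), o) ∉ E)
    {δ : ℝ≥0∞} (hδ : δ ≠ 0) (hδ' : δ ≠ ∞) (L : ℕ) [NeZero L] (M : ℕ) [NeZero M] :
    ∃ (a : Fin M → α) (f : Fin M → σ → χ) (hf : ∀ m, Measurable (f m)) (dec : β → Fin M),
      Measurable dec ∧
      ∑ m, wordLaw κ ch (a m) (f m) (hf m)
        {y | dec (v y) ≠ m ∨ (((a m, y.1), f m y.1.1), y.2) ∈ E} ≤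
      M * (((μ ⊗ₘ κ.fst) ⊗ₘ aux) G₀ᶜ + jointLaw μ κ aux inp ch B / δ +
          ENNReal.ofReal (Real.exp (-(L / K))) + δ + (M - 1 : ℕ) * (L * t)) := by
  obtain ⟨Q, _, ρ, _, a, ha, u, hu, f, hf, Err, hErr, hlaw, hgood, hle⟩ :=
    exists_random_codeword μ κ aux inp ch auxA hG₀ hK hdens hB hδ hδ' L
  set η := ((μ ⊗ₘ κ.fst) ⊗ₘ aux) G₀ᶜ + jointLaw μ κ aux inp ch B / δ +
          ENNReal.ofReal (Real.exp (-(L / K))) + δ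
  set Λ := wordKernel κ ch a ha f hf
  -- The values that some auxiliary word of the codeword `q` claims.
  let D : Set (Q × β) := {z | ∃ l, ((a z.1, u l z.1), z.2) ∈ T}
  have hD : MeasurableSet D := by
    have : D = ⋃ l, {z | ((a z.1, u l z.1), z.2) ∈ T} := by ext z; simp [D]
    rw [this]
    exact MeasurableSet.iUnion fun l =>
      (by have := hu l; fun_prop : Measurable fun z : Q × β => ((a z.1, u l z.1), z.2)) hT
  have hDt : ∀ w, ρ {q | (q, w) ∈ D} ≤ L * t := fun w => by
    calc ρ {q | (q, w) ∈ D} = ρ (⋃ l, {q | ((a q, u l q), w) ∈ T}) := by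
          congr 1; ext q; simp [D]
      _ ≤ ∑ l, ρ {q | ((a q, u l q), w) ∈ T} := measure_iUnion_fintype_le _ _
      _ ≤ ∑ _l : Fin L, t := by
          refine Finset.sum_le_sum fun l _ => ?_
          have := hTt w
          have hTw : MeasurableSet {z | (z, w) ∈ T} := measurable_prodMk_right hT
          rwa [← hlaw l, Measure.map_apply (ha.prodMk (hu l)) hTw] at this
      _ = L * t := by simp
  let F₁ : Q → ℝ≥0∞ := fun q => Λ q {y | (q, y) ∈ Err}
  let F₂ : Q × Q → ℝ≥0∞ := fun z => Λ z.1 {y | (z.2, v y) ∈ D}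
  have hF₁ : Measurable F₁ := Kernel.measurable_kernel_prodMk_left hErr
  have hF₂ : Measurable F₂ := Kernel.measurable_kernel_prodMk_left
    (κ := Λ.comap (fun z : Q × Q => z.1) measurable_fst)
    (t := (fun z : (Q × Q) × ((σ × τ) × ω) => (z.1.2, v z.2)) ⁻¹' D)
    ((by fun_prop : Measurable _) hD)
  have hI₁ : ∫⁻ q, F₁ q ∂ρ ≤ η := by
    rwa [Measure.compProd_apply hErr] at hle
  have hI₂ : ∫⁻ z, F₂ z ∂(ρ.prod ρ) ≤ L * t := by
    rw [lintegral_prod _ hF₂.aemeasurable]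
    refine (lintegral_mono (g := fun _ => L * t) fun q => ?_).trans_eq (by simp)
    have hDv : MeasurableSet {z : Q × ((σ × τ) × ω) | (z.1, v z.2) ∈ D} :=
      (by fun_prop : Measurable fun z : Q × ((σ × τ) × ω) => (z.1, v z.2)) hD
    calc ∫⁻ q', F₂ (q, q') ∂ρ = (ρ.prod (Λ q)) {z | (z.1, v z.2) ∈ D} :=
          (Measure.prod_apply (μ := ρ) (ν := Λ q) hDv).symm
      _ = ∫⁻ y, ρ {q' | (q', v y) ∈ D} ∂Λ q := Measure.prod_apply_symm hDv
      _ ≤ ∫⁻ _, L * t ∂Λ q := lintegral_mono fun y => hDt (v y)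
      _ = L * t := by simp
  let F : (Fin M → Q) → ℝ≥0∞ := fun c =>
    ∑ m, (F₁ (c m) + ∑ m' ∈ Finset.univ.erase m, F₂ (c m, c m'))
  have hF : Measurable F := by fun_prop
  have hIF : ∫⁻ c, F c ∂(Measure.pi fun _ : Fin M => ρ) ≤ M * (η + (M - 1 : ℕ) * (L * t)) := by
    rw [lintegral_finsetSum _ fun m _ => by fun_prop]
    calc _ ≤ ∑ _m : Fin M, (η + (M - 1 : ℕ) * (L * t)) := by
          refine Finset.sum_le_sum fun m _ => ?_
          rw [lintegral_add_left (by fun_prop), lintegral_finsetSum _ fun m _ => by fun_prop]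
          refine add_le_add ?_ ?_
          · exact ((measurePreserving_eval (fun _ : Fin M => ρ) m).lintegral_comp hF₁).trans_le hI₁
          · calc _ ≤ ∑ _m' ∈ Finset.univ.erase m, L * t := by
                  refine Finset.sum_le_sum fun m' hm' => ?_
                  have hne : m ≠ m' := (Finset.ne_of_mem_erase hm').symm
                  rw [← map_pi_eval_pair ρ hne, lintegral_map hF₂ (by fun_prop)] at hI₂
                  exact hI₂
              _ = _ := by
                  rw [Finset.sum_const, Finset.card_erase_of_mem (Finset.mem_univ _),
                    Finset.card_univ, Fintype.card_fin, nsmul_eq_mul]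
      _ = _ := by
          rw [Finset.sum_const, Finset.card_univ, Fintype.card_fin, nsmul_eq_mul]
  obtain ⟨c, hc⟩ := exists_le_lintegral (μ := Measure.pi fun _ : Fin M => ρ) hF.aemeasurable
  obtain ⟨dec, hdec, hdecD⟩ := exists_measurable_selector (X := β) (ι := Fin M)
    (fun m => {w | (c m, w) ∈ D}) (fun m => measurable_prodMk_left hD)
  refine ⟨fun m => a (c m), fun m s => f (c m, s), fun m => hf.comp measurable_prodMk_left,
    dec, hdec, le_trans ?_ (hc.trans hIF)⟩
  refine Finset.sum_le_sum fun m _ => ?_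
  rw [← wordKernel_apply κ ch a ha f hf (c m)]
  calc Λ (c m) {y | dec (v y) ≠ m ∨ (((a (c m), y.1), f (c m, y.1.1)), y.2) ∈ E}
      ≤ Λ (c m) ({y | (c m, y) ∈ Err} ∪
        ⋃ m' ∈ Finset.univ.erase m, {y | (c m', v y) ∈ D}) := by
        refine measure_mono fun y hy => ?_
        by_contra hcon
        rw [Set.mem_union, not_or] at hcon
        obtain ⟨l, hl⟩ := hgood (c m) y hcon.1
        obtain ⟨hyT, hyE⟩ := hBTE _ _ _ _ _ hl
        -- The codeword sent claims the output, so the decoder names a codeword that does, and no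
        -- other one does.
        have hsel := hdecD (v y) m ⟨l, hyT⟩
        refine hy.elim (fun hne => hcon.2 ?_) hyE
        exact Set.mem_biUnion (Finset.mem_coe.2 (Finset.mem_erase.2 ⟨hne, Finset.mem_univ _⟩)) hsel
    _ ≤ F₁ (c m) + ∑ m' ∈ Finset.univ.erase m, F₂ (c m, c m') :=
        (measure_union_le _ _).trans (add_le_add_right (measure_biUnion_finset_le _ _) _)

end Packing

/-! ### Conditional independence and marginals -/

section CondProduct

variable {α σ τ υ χ ω : Type*} [MeasurableSpace α] [MeasurableSpace σ] [MeasurableSpace τ]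
  [MeasurableSpace υ] [MeasurableSpace χ] [MeasurableSpace ω]

lemma map_compProd_map {γ δ : Type*} [MeasurableSpace γ] [MeasurableSpace δ] (μ : Measure α)
    [SFinite μ] (η : Kernel α γ) [IsMarkovKernel η] {f : γ → δ} (hf : Measurable f) :
    (μ ⊗ₘ η).map (fun z => (z.1, f z.2)) = μ ⊗ₘ η.map f := by
  have : IsMarkovKernel (η.map f) := Kernel.IsMarkovKernel.map η hf
  have hm : Measurable (fun z : α × γ => (z.1, f z.2)) := by fun_prop
  ext S hS
  rw [Measure.map_apply hm hS, Measure.compProd_apply (hm hS), Measure.compProd_apply hS]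
  refine lintegral_congr fun a => ?_
  rw [Kernel.map_apply' _ hf _ (measurable_prodMk_left hS)]
  rfl

/-- The law of `(a, (u, s))` with `u` and `s` conditionally independent given `a`, drawn by first
choosing `(a, s)`. -/
lemma compProd_prod_eq_map (μ : Measure α) [IsProbabilityMeasure μ] (η₁ : Kernel α υ)
    [IsMarkovKernel η₁] (η₂ : Kernel α σ) [IsMarkovKernel η₂] :
    μ ⊗ₘ (η₁ ×ₖ η₂) =
      ((μ ⊗ₘ η₂) ⊗ₘ Kernel.prodMkRight σ η₁).map (fun z => (z.1.1, (z.2, z.1.2))) := by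
  have hm : Measurable (fun z : (α × σ) × υ => (z.1.1, (z.2, z.1.2))) := by fun_prop
  ext S hS
  rw [Measure.map_apply hm hS, Measure.compProd_apply (hm hS), Measure.compProd_apply hS,
    Measure.lintegral_compProd (Kernel.measurable_kernel_prodMk_left (hm hS))]
  refine lintegral_congr fun a => ?_
  rw [Kernel.prod_apply, Measure.prod_apply_symm (measurable_prodMk_left hS)]
  rfl

lemma jointLaw_map (μ : Measure α) [IsProbabilityMeasure μ] (κ : Kernel α (σ × τ))
    [IsMarkovKernel κ] (aux : Kernel (α × σ) υ) [IsMarkovKernel aux] (inp : Kernel (υ × σ) χ)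
    [IsMarkovKernel inp] (ch : Kernel (χ × τ) ω) [IsMarkovKernel ch] :
    (jointLaw μ κ aux inp ch).map (fun z => ((z.1.1.1.1, z.1.1.1.2.1), z.1.1.2)) =
      (μ ⊗ₘ κ.fst) ⊗ₘ aux := by
  have hm : Measurable (fun z : (((α × (σ × τ)) × υ) × χ) × ω =>
    ((z.1.1.1.1, z.1.1.1.2.1), z.1.1.2)) := by fun_prop
  refine Measure.ext_of_lintegral _ fun f hf => ?_
  rw [lintegral_map hf hm, lintegral_jointLaw _ _ _ _ _ (by fun_prop),
    Measure.lintegral_compProd hf, Measure.lintegral_compProd (by fun_prop)]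
  refine lintegral_congr fun a => ?_
  simp only [lintegral_const, measure_univ, mul_one]
  have h : Measurable fun s => ∫⁻ u, f ((a, s), u) ∂aux (a, s) :=
    (hf.lintegral_kernel_prod_right' (κ := aux)).comp measurable_prodMk_left
  rw [Kernel.fst_apply, lintegral_map h measurable_fst]

lemma map_compProd_compProd_map_fst (μ : Measure α) [IsProbabilityMeasure μ] (η : Kernel α σ)
    [IsMarkovKernel η] (aux : Kernel (α × σ) υ) [IsMarkovKernel aux] :
    ((((μ ⊗ₘ η) ⊗ₘ aux).map (fun z => (z.1.1, (z.2, z.1.2)))).map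
      (fun z => (z.1, z.2.2))) = μ ⊗ₘ η := by
  rw [Measure.map_map (by fun_prop) (by fun_prop)]
  exact Measure.fst_compProd (μ ⊗ₘ η) aux

lemma fst_map_compProd_compProd (μ : Measure α) [IsProbabilityMeasure μ] (η : Kernel α σ)
    [IsMarkovKernel η] (aux : Kernel (α × σ) υ) [IsMarkovKernel aux] :
    (((μ ⊗ₘ η) ⊗ₘ aux).map (fun z => (z.1.1, (z.2, z.1.2)))).fst = μ := by
  calc _ = (((μ ⊗ₘ η) ⊗ₘ aux).fst).fst := by
        simp only [Measure.fst]
        rw [Measure.map_map (by fun_prop) (by fun_prop), Measure.map_map (by fun_prop)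
          (by fun_prop)]
        rfl
    _ = μ := by rw [Measure.fst_compProd, Measure.fst_compProd]

variable [StandardBorelSpace υ] [Nonempty υ] [StandardBorelSpace σ] [Nonempty σ]

/-- The conditional product is determined by the laws of `(a, u)` and of `(a, s)`. -/
lemma condProduct_eq (P : Measure (α × (υ × σ))) [IsProbabilityMeasure P] (η₁ : Kernel α υ)
    [IsMarkovKernel η₁] (η₂ : Kernel α σ) [IsMarkovKernel η₂]
    (h₁ : P.map (fun z => (z.1, z.2.1)) = P.fst ⊗ₘ η₁)
    (h₂ : P.map (fun z => (z.1, z.2.2)) = P.fst ⊗ₘ η₂) :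
    condProduct P = P.fst ⊗ₘ (η₁ ×ₖ η₂) := by
  have e₁ : P.condKernel.fst =ᵐ[P.fst] η₁ := Kernel.ae_eq_of_compProd_eq (by
    rw [← h₁, Kernel.fst_eq, ← map_compProd_map _ _ measurable_fst, P.disintegrate])
  have e₂ : P.condKernel.snd =ᵐ[P.fst] η₂ := Kernel.ae_eq_of_compProd_eq (by
    rw [← h₂, Kernel.snd_eq, ← map_compProd_map _ _ measurable_snd, P.disintegrate])
  refine Measure.compProd_congr ?_
  filter_upwards [e₁, e₂] with a h1 h2
  change (P.condKernel.fst ×ₖ P.condKernel.snd) a = _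
  rw [Kernel.prod_apply, Kernel.prod_apply, h1, h2]

lemma map_eq_compProd_condKernel_fst (P : Measure (α × (υ × σ))) [IsProbabilityMeasure P] :
    P.map (fun z => (z.1, z.2.1)) = P.fst ⊗ₘ P.condKernel.fst := by
  rw [Kernel.fst_eq, ← map_compProd_map _ _ measurable_fst, P.disintegrate]

instance (P : Measure (α × (υ × σ))) [IsProbabilityMeasure P] :
    IsProbabilityMeasure (condProduct P) := by
  unfold condProduct
  have : IsMarkovKernel (P.condKernel.fst.prod P.condKernel.snd) :=
    inferInstanceAs (IsMarkovKernel (P.condKernel.fst ×ₖ P.condKernel.snd))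
  infer_instance

/-- For the law of `(a, (u, s))`, the conditional product arises when the kernel for `u` given
`(a, s)` is replaced by the one for `u` given `a`. -/
lemma condProduct_map_compProd (μ : Measure α) [IsProbabilityMeasure μ] (η : Kernel α σ)
    [IsMarkovKernel η] (aux : Kernel (α × σ) υ) [IsMarkovKernel aux]
    (P : Measure (α × (υ × σ))) [IsProbabilityMeasure P]
    (hP : P = ((μ ⊗ₘ η) ⊗ₘ aux).map (fun z => (z.1.1, (z.2, z.1.2)))) :
    condProduct P = ((μ ⊗ₘ η) ⊗ₘ Kernel.prodMkRight σ P.condKernel.fst).map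
      (fun z => (z.1.1, (z.2, z.1.2))) := by
  have hfst : P.fst = μ := by rw [hP, fst_map_compProd_compProd]
  rw [condProduct_eq P P.condKernel.fst η (map_eq_compProd_condKernel_fst P)
    (by rw [hfst, hP, map_compProd_compProd_map_fst]), hfst, compProd_prod_eq_map]

end CondProduct

/-! ### Codes of fixed blocklength -/

section Blocklength

variable {A Se S Sd X Y Z R U : Type u}
  [MeasurableSpace A] [MeasurableSpace Se] [MeasurableSpace S] [MeasurableSpace Sd]
  [MeasurableSpace X] [MeasurableSpace Y] [MeasurableSpace Z] [MeasurableSpace R]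
  [MeasurableSpace U]

/-- The channel with the decoder side information as an additional argument, on which it does not
depend. With this channel, `GenProcess.law` is by definition an instance of `jointLaw`, and
`Code.lawGiven` one of `wordLaw`. -/
def Model.extChannel (W : Model A Se S Sd X Y Z R) (n : ℕ) :
    Kernel ((Fin n → X) × ((Fin n → S) × (Fin n → Sd))) ((Fin n → Y) × (Fin n → Z)) :=
  (W.channel n).comap (fun z => (z.1, z.2.1)) (measurable_fst.prodMk measurable_snd.fst)

instance (W : Model A Se S Sd X Y Z R) (n : ℕ) : IsMarkovKernel (W.extChannel n) := by
  unfold Model.extChannel; infer_instance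

instance (W : Model A Se S Sd X Y Z R) {n : ℕ} (C : Code A Se Sd X Y Z R n)
    (m : Fin C.numMsg) : IsProbabilityMeasure (C.lawGiven W m) := by
  unfold Code.lawGiven; infer_instance

lemma Code.law_apply (W : Model A Se S Sd X Y Z R) {n : ℕ} (C : Code A Se Sd X Y Z R n)
    {E : Set (Fin C.numMsg ×
      (((Fin n → Se) × (Fin n → S) × (Fin n → Sd)) × ((Fin n → Y) × (Fin n → Z))))}
    (hE : MeasurableSet E) :
    C.law W E = (C.numMsg : ℝ≥0∞)⁻¹ * ∑ m, C.lawGiven W m {y | (m, y) ∈ E} := by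
  rw [Code.law, Measure.smul_apply, Measure.finsetSum_apply, smul_eq_mul]
  congr 1
  refine Finset.sum_congr rfl fun m _ => ?_
  rw [Measure.dirac_prod, Measure.map_apply measurable_prodMk_left hE]
  rfl

lemma measurable_distortion_aux (W : Model A Se S Sd X Y Z R) {n : ℕ} (g : Estimator A Se X Z R n) :
    Measurable (fun z : (Fin n → S) × (Fin n → X) × (Fin n → A) × (Fin n → Se) × (Fin n → Z) =>
      (((W.dist n z.1 (g.toFun z.2.1 z.2.2.1 z.2.2.2.1 z.2.2.2.2) : ℝ) / n : ℝ) : EReal)) := by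
  have h : Measurable (fun z : (Fin n → S) × (Fin n → X) × (Fin n → A) × (Fin n → Se) ×
      (Fin n → Z) => W.dist n z.1 (g.toFun z.2.1 z.2.2.1 z.2.2.2.1 z.2.2.2.2)) :=
    (W.measurable_dist n).comp (measurable_fst.prodMk (g.measurable_toFun.comp measurable_snd))
  fun_prop

lemma Code.measurable_distortion (W : Model A Se S Sd X Y Z R) {n : ℕ}
    (C : Code A Se Sd X Y Z R n) : Measurable (C.distortion W) := by
  refine measurable_from_prod_countable_right fun m => ?_
  have h := C.measurable_enc m
  exact (measurable_distortion_aux W C.est).comp (by fun_prop : Measurable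
    fun y : ((Fin n → Se) × (Fin n → S) × (Fin n → Sd)) × ((Fin n → Y) × (Fin n → Z)) =>
      (y.1.2.1, C.enc m y.1.1, C.actionEnc m, y.1.1, y.2.2))

lemma Code.measurableSet_error {n : ℕ} (C : Code A Se Sd X Y Z R n) :
    MeasurableSet {ω : Fin C.numMsg ×
      (((Fin n → Se) × (Fin n → S) × (Fin n → Sd)) × ((Fin n → Y) × (Fin n → Z))) |
        C.dec ω.2.2.1 ω.2.1.2.2 ≠ ω.1} := by
  have h : Measurable fun ω : Fin C.numMsg ×
      (((Fin n → Se) × (Fin n → S) × (Fin n → Sd)) × ((Fin n → Y) × (Fin n → Z))) =>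
        C.dec ω.2.2.1 ω.2.1.2.2 :=
    C.measurable_dec.comp (by fun_prop : Measurable fun ω : Fin C.numMsg ×
      (((Fin n → Se) × (Fin n → S) × (Fin n → Sd)) × ((Fin n → Y) × (Fin n → Z))) =>
        (ω.2.2.1, ω.2.1.2.2))
  exact (measurableSet_eq_fun h measurable_fst).compl

/-- A code of blocklength `n` built from a process: the event that the decoder errs or that the
distortion exceeds `D` is controlled by the covering, packing and distortion terms. -/
lemma exists_code [StandardBorelSpace A] [StandardBorelSpace Se] [StandardBorelSpace S]
    [StandardBorelSpace Sd] [StandardBorelSpace X] [Nonempty Se] [StandardBorelSpace U] [Nonempty U]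
    (W : Model A Se S Sd X Y Z R) (p : GenProcess A Se X U) (n : ℕ) (g : Estimator A Se X Z R n)
    {K : ℝ} (hK : 0 < K) {T : Set (((Fin n → A) × (Fin n → U)) × ((Fin n → Y) × (Fin n → Sd)))}
    (hT : MeasurableSet T) {t : ℝ≥0∞}
    (hTt : ∀ w, (p.law W n).map (fun ω => (ω.1.1.1.1, ω.1.1.2)) {z | (z, w) ∈ T} ≤ t) (D : ℝ)
    {δ : ℝ≥0∞} (hδ : δ ≠ 0) (hδ' : δ ≠ ∞) {L : ℕ} (hL : 0 < L) {M : ℕ} (hM : 0 < M) :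
    ∃ C : Code A Se Sd X Y Z R n, C.numMsg = M ∧
      C.law W {ω | C.dec ω.2.2.1 ω.2.1.2.2 ≠ ω.1 ∨ (D : EReal) < C.distortion W ω} ≤
        (p.law W n).map (fun ω => (ω.1.1.1.1, (ω.1.1.2, ω.1.1.1.2.1)))
          {z | ENNReal.ofReal K < likelihoodRatio
            ((p.law W n).map (fun ω => (ω.1.1.1.1, (ω.1.1.2, ω.1.1.1.2.1))))
            (condProduct ((p.law W n).map (fun ω => (ω.1.1.1.1, (ω.1.1.2, ω.1.1.1.2.1))))) z} +
        (p.law W n {ω | ((ω.1.1.1.1, ω.1.1.2), (ω.2.1, ω.1.1.1.2.2.2)) ∉ T} +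
          p.law W n {ω | (D : EReal) < (((W.dist n ω.1.1.1.2.2.1
            (g.toFun ω.1.2 ω.1.1.1.1 ω.1.1.1.2.1 ω.2.2) : ℝ) / n : ℝ) : EReal)}) / δ +
        ENNReal.ofReal (Real.exp (-(L / K))) + δ + (M - 1 : ℕ) * (L * t) := by
  have : NeZero L := ⟨hL.ne'⟩
  have : NeZero M := ⟨hM.ne'⟩
  obtain ⟨⟨⟨⟨⟨_, ⟨_, s₀, d₀⟩⟩, _⟩, x₀⟩, _⟩⟩ := nonempty_of_isProbabilityMeasure (p.law W n)
  have : Nonempty ((Fin n → S) × (Fin n → Sd)) := ⟨(s₀, d₀)⟩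
  have : Nonempty (Fin n → X) := ⟨x₀⟩
  set P := (p.law W n).map (fun ω => (ω.1.1.1.1, (ω.1.1.2, ω.1.1.1.2.1))) with hPdef
  have : IsProbabilityMeasure P := Measure.isProbabilityMeasure_map (by fun_prop)
  have hJ : (p.law W n).map (fun ω => ((ω.1.1.1.1, ω.1.1.1.2.1), ω.1.1.2)) =
      (p.action n ⊗ₘ (W.state n).fst) ⊗ₘ p.aux n :=
    jointLaw_map (p.action n) (W.state n) (p.aux n) (p.input n) (W.extChannel n)
  have hP : P = ((p.action n ⊗ₘ (W.state n).fst) ⊗ₘ p.aux n).map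
      (fun z => (z.1.1, (z.2, z.1.2))) := by
    rw [← hJ, Measure.map_map (by fun_prop) (by fun_prop)]
    rfl
  have hPc := condProduct_map_compProd _ _ _ P hP
  have hfst : P.fst = p.action n := by rw [hP, fst_map_compProd_compProd]
  have hAU : (p.law W n).map (fun ω => (ω.1.1.1.1, ω.1.1.2)) =
      p.action n ⊗ₘ P.condKernel.fst := by
    rw [← hfst, ← map_eq_compProd_condKernel_fst, hPdef,
      Measure.map_map (by fun_prop) (by fun_prop)]
    rfl
  have he : Measurable (fun z : ((Fin n → A) × (Fin n → Se)) × (Fin n → U) =>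
    (z.1.1, (z.2, z.1.2))) := by fun_prop
  have hPapp : ∀ F, MeasurableSet F → P F = ((p.action n ⊗ₘ (W.state n).fst) ⊗ₘ p.aux n)
      ((fun z => (z.1.1, (z.2, z.1.2))) ⁻¹' F) := fun F hF => by
    rw [hP, Measure.map_apply he hF]
  have he' : Measurable (fun z : (Fin n → A) × ((Fin n → U) × (Fin n → Se)) =>
    ((z.1, z.2.2), z.2.1)) := by fun_prop
  have hr := measurable_likelihoodRatio P (condProduct P)
  have hset : MeasurableSet {z | likelihoodRatio P (condProduct P) z ≤ ENNReal.ofReal K} :=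
    measurableSet_le hr measurable_const
  have hdens : ∀ F, MeasurableSet F → ((p.action n ⊗ₘ (W.state n).fst) ⊗ₘ p.aux n)
      (F ∩ (fun z => (z.1.1, (z.2, z.1.2))) ⁻¹'
        {z | likelihoodRatio P (condProduct P) z ≤ ENNReal.ofReal K}) ≤
      ENNReal.ofReal K * ((p.action n ⊗ₘ (W.state n).fst) ⊗ₘ
        Kernel.prodMkRight (Fin n → Se) P.condKernel.fst) F := by
    intro F hF
    have h := measure_inter_likelihoodRatio_le P (condProduct P)
      (ENNReal.ofReal_ne_top (r := K)) (he' hF)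
    have e₁ : P ((fun z => ((z.1, z.2.2), z.2.1)) ⁻¹' F ∩
        {z | likelihoodRatio P (condProduct P) z ≤ ENNReal.ofReal K}) =
        ((p.action n ⊗ₘ (W.state n).fst) ⊗ₘ p.aux n)
      (F ∩ (fun z => (z.1.1, (z.2, z.1.2))) ⁻¹'
        {z | likelihoodRatio P (condProduct P) z ≤ ENNReal.ofReal K}) := by
      exact hPapp _ ((he' hF).inter hset)
    have e₂ : condProduct P ((fun z => ((z.1, z.2.2), z.2.1)) ⁻¹' F) =
        ((p.action n ⊗ₘ (W.state n).fst) ⊗ₘ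
        Kernel.prodMkRight (Fin n → Se) P.condKernel.fst) F := by
      rw [hPc, Measure.map_apply he (he' hF)]
      rfl
    rwa [e₁, e₂] at h
  have hd := measurable_distortion_aux W g
  let E : Set ((((Fin n → A) × ((Fin n → Se) × (Fin n → S) × (Fin n → Sd))) × (Fin n → X)) ×
      ((Fin n → Y) × (Fin n → Z))) :=
    {z | (D : EReal) < (((W.dist n z.1.1.2.2.1
      (g.toFun z.1.2 z.1.1.1 z.1.1.2.1 z.2.2) : ℝ) / n : ℝ) : EReal)}
  let B₁ : Set (((((Fin n → A) × ((Fin n → Se) × (Fin n → S) × (Fin n → Sd))) × (Fin n → U)) ×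
      (Fin n → X)) × ((Fin n → Y) × (Fin n → Z))) :=
    {ω | ((ω.1.1.1.1, ω.1.1.2), (ω.2.1, ω.1.1.1.2.2.2)) ∉ T}
  let B₂ : Set (((((Fin n → A) × ((Fin n → Se) × (Fin n → S) × (Fin n → Sd))) × (Fin n → U)) ×
      (Fin n → X)) × ((Fin n → Y) × (Fin n → Z))) :=
    {ω | (D : EReal) < (((W.dist n ω.1.1.1.2.2.1
      (g.toFun ω.1.2 ω.1.1.1.1 ω.1.1.1.2.1 ω.2.2) : ℝ) / n : ℝ) : EReal)}
  have hB₁ : MeasurableSet B₁ := (by fun_prop : Measurable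
    fun ω : ((((Fin n → A) × ((Fin n → Se) × (Fin n → S) × (Fin n → Sd))) × (Fin n → U)) ×
      (Fin n → X)) × ((Fin n → Y) × (Fin n → Z)) =>
      ((ω.1.1.1.1, ω.1.1.2), (ω.2.1, ω.1.1.1.2.2.2))) hT.compl
  have hB₂ : MeasurableSet B₂ := measurableSet_lt measurable_const (hd.comp
    (by fun_prop : Measurable
    fun ω : ((((Fin n → A) × ((Fin n → Se) × (Fin n → S) × (Fin n → Sd))) × (Fin n → U)) ×
      (Fin n → X)) × ((Fin n → Y) × (Fin n → Z)) =>
      (ω.1.1.1.2.2.1, ω.1.2, ω.1.1.1.1, ω.1.1.1.2.1, ω.2.2)))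
  obtain ⟨a, f, hf, dec, hdec, hle⟩ := exists_oneShot_code (p.action n) (W.state n) (p.aux n)
    (p.input n) (W.extChannel n) P.condKernel.fst (he hset) hK hdens (hB₁.union hB₂)
    (v := fun y => (y.2.1, y.1.2.2)) (by fun_prop) hT (by rwa [hAU] at hTt) (E := E)
    (fun a y u x o h => by
      rw [Set.mem_union, not_or] at h
      exact ⟨not_not.1 h.1, h.2⟩) hδ hδ' L M
  let C : Code A Se Sd X Y Z R n :=
    { numMsg := M
      numMsg_pos := hM
      actionEnc := a
      enc := f
      measurable_enc := hf
      dec := fun y d => dec (y, d)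
      measurable_dec := hdec
      est := g }
  refine ⟨C, rfl, ?_⟩
  have hM0 : (M : ℝ≥0∞) ≠ 0 := by exact_mod_cast hM.ne'
  have hEv : MeasurableSet {ω | C.dec ω.2.2.1 ω.2.1.2.2 ≠ ω.1 ∨ (D : EReal) < C.distortion W ω} :=
    C.measurableSet_error.union (measurableSet_lt measurable_const (C.measurable_distortion W))
  rw [C.law_apply W hEv]
  refine (mul_le_mul_right hle _).trans ?_
  rw [← mul_assoc, ENNReal.inv_mul_cancel hM0 (ENNReal.natCast_ne_top M), one_mul]
  gcongr
  · refine le_of_eq (Eq.trans ?_ (hPapp _ (measurableSet_lt measurable_const hr)).symm)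
    congr 1
    ext z
    simp
  · exact measure_union_le _ _

end Blocklength

/-! ### Achievability -/

section Achievability

variable {A Se S Sd X Y Z R U : Type u}
  [MeasurableSpace A] [MeasurableSpace Se] [MeasurableSpace S] [MeasurableSpace Sd]
  [MeasurableSpace X] [MeasurableSpace Y] [MeasurableSpace Z] [MeasurableSpace R]
  [MeasurableSpace U]

lemma tendsto_ofReal_one_div_comp {k : ℕ → ℕ} (hk : Tendsto k atTop atTop) :
    Tendsto (fun n => ENNReal.ofReal (1 / ((k n : ℝ) + 1))) atTop (𝓝 0) := by
  rw [← ENNReal.ofReal_zero]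
  exact ENNReal.tendsto_ofReal (tendsto_one_div_add_atTop_nhds_zero_nat.comp hk)

/-- Number of messages times number of auxiliary words per message times the false alarm
probability of the decoding sets, for rates `r + b < a`. -/
lemma tendsto_packing_term {r a b : ℝ} (hb : 0 ≤ b) (h : r + b < a) :
    Tendsto (fun n : ℕ => ((⌈Real.exp (n * r)⌉₊ - 1 : ℕ) : ℝ≥0∞) *
      ((⌈Real.exp (n * b)⌉₊ : ℝ≥0∞) * ENNReal.ofReal (Real.exp (-(n * a))))) atTop (𝓝 0) := by
  have h0 : Tendsto (fun n : ℕ => 2 * ENNReal.ofReal (Real.exp (n * (r + b - a)))) atTop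
      (𝓝 (2 * 0)) := ENNReal.Tendsto.const_mul
    (tendsto_exp_nat_mul_atTop_nhds_zero (by linarith)) (Or.inr (by simp))
  rw [mul_zero] at h0
  refine tendsto_of_tendsto_of_tendsto_of_le_of_le tendsto_const_nhds h0 (fun _ => zero_le)
    fun n => ?_
  have h1 : ((⌈Real.exp (n * r)⌉₊ - 1 : ℕ) : ℝ≥0∞) ≤ ENNReal.ofReal (Real.exp (n * r)) := by
    rw [← ENNReal.ofReal_natCast]
    apply ENNReal.ofReal_le_ofReal
    have h2 := Nat.ceil_lt_add_one (Real.exp_pos (n * r)).le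
    have h3 : 1 ≤ ⌈Real.exp (n * r)⌉₊ := Nat.one_le_iff_ne_zero.2
      (Nat.ceil_pos.2 (Real.exp_pos _)).ne'
    push_cast [Nat.cast_sub h3]
    linarith
  have h2 : (⌈Real.exp (n * b)⌉₊ : ℝ≥0∞) ≤ ENNReal.ofReal (2 * Real.exp (n * b)) := by
    rw [← ENNReal.ofReal_natCast]
    apply ENNReal.ofReal_le_ofReal
    have h2 := Nat.ceil_lt_add_one (Real.exp_pos (n * b)).le
    have h3 : 1 ≤ Real.exp (n * b) := Real.one_le_exp (by positivity)
    linarith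
  calc _ ≤ ENNReal.ofReal (Real.exp (n * r)) * (ENNReal.ofReal (2 * Real.exp (n * b)) *
        ENNReal.ofReal (Real.exp (-(n * a)))) := by gcongr
    _ = _ := by
      have h2 : (2 : ℝ≥0∞) = ENNReal.ofReal 2 := by simp
      rw [h2, ← ENNReal.ofReal_mul (by positivity), ← ENNReal.ofReal_mul (by positivity),
        ← ENNReal.ofReal_mul (by positivity)]
      congr 1
      have h5 : (n : ℝ) * (r + b - a) = n * r + n * b + -(n * a) := by ring
      rw [h5, Real.exp_add, Real.exp_add]
      ring

lemma tendsto_covering_term {b c : ℝ} (h : c < b) :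
    Tendsto (fun n : ℕ => ENNReal.ofReal (Real.exp
      (-((⌈Real.exp (n * b)⌉₊ : ℝ) / Real.exp (n * c))))) atTop (𝓝 0) := by
  rw [← ENNReal.ofReal_zero]
  refine ENNReal.tendsto_ofReal (Real.tendsto_exp_neg_atTop_nhds_zero.comp ?_)
  have h1 : Tendsto (fun n : ℕ => Real.exp (n * (b - c))) atTop atTop :=
    Real.tendsto_exp_atTop.comp
      ((tendsto_natCast_atTop_atTop (R := ℝ)).atTop_mul_const (sub_pos.2 h))
  refine tendsto_atTop_mono (fun n => ?_) h1
  rw [mul_sub, Real.exp_sub]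
  gcongr
  exact Nat.le_ceil _

/-- Rates `r < a - I(U; Se | A)` are achievable, if there are decoding sets with false alarm
probability `exp (-n a)` that contain the process with probability tending to one. -/
theorem GenProcess.achievable [StandardBorelSpace A] [StandardBorelSpace Se] [StandardBorelSpace S]
    [StandardBorelSpace Sd] [StandardBorelSpace X] [Nonempty Se] [StandardBorelSpace U] [Nonempty U]
    (W : Model A Se S Sd X Y Z R) (p : GenProcess A Se X U) {D : ℝ} (hD : p.MeetsDistortion W D)
    {T : ∀ n, Set (((Fin n → A) × (Fin n → U)) × ((Fin n → Y) × (Fin n → Sd)))}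
    (hT : ∀ n, MeasurableSet (T n)) {a r : ℝ}
    (hTt : ∀ n w, (p.law W n).map (fun ω => (ω.1.1.1.1, ω.1.1.2)) {z | (z, w) ∈ T n} ≤
      ENNReal.ofReal (Real.exp (-(n * a))))
    (hTc : Tendsto (fun n => p.law W n
      {ω | ((ω.1.1.1.1, ω.1.1.2), (ω.2.1, ω.1.1.1.2.2.2)) ∉ T n}) atTop (𝓝 0))
    (hr : p.supInfoCond W < ((a - r : ℝ) : EReal)) : W.Achievable r D := by
  obtain ⟨g, hg⟩ := hD
  have : ∀ n, IsProbabilityMeasure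
      ((p.law W n).map (fun ω => (ω.1.1.1.1, (ω.1.1.2, ω.1.1.1.2.1)))) := fun n =>
    Measure.isProbabilityMeasure_map (by fun_prop)
  obtain ⟨b, hb, hba⟩ := EReal.lt_iff_exists_real_btwn.1 hr
  obtain ⟨c, hc, hcb⟩ := EReal.lt_iff_exists_real_btwn.1 hb
  have hcb : c < b := EReal.coe_lt_coe_iff.1 hcb
  have hba : b < a - r := EReal.coe_lt_coe_iff.1 hba
  have hc0 : (0 : EReal) ≤ c := (zero_le_pLimsup_logRatioRate _ _).trans hc.le
  have hc0 : 0 ≤ c := by exact_mod_cast hc0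
  have hcov := tendsto_measure_of_pLimsup_lt hc
  -- `exp (n r)` messages with `exp (n b)` auxiliary words each, and the bound `exp (n c)` on the
  -- density of the auxiliary words. As `b` is nonnegative, rounding up at most doubles `exp (n b)`.
  let M : ℕ → ℕ := fun n => ⌈Real.exp (n * r)⌉₊
  have hM : ∀ n, 0 < M n := fun n => Nat.ceil_pos.2 (Real.exp_pos _)
  -- The margin in the distortion and the bound on the conditional probability of the bad event both
  -- tend to zero slowly, along the diagonal sequence `k n`.
  let δ : ℕ → ℝ≥0∞ := fun k => ENNReal.ofReal (1 / ((k : ℝ) + 1))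
  have hδ : ∀ k, δ k ≠ 0 := fun k => (ENNReal.ofReal_pos.2 (by positivity)).ne'
  have hδ' : ∀ k, δ k ≠ ∞ := fun k => ENNReal.ofReal_ne_top
  let Good : ℕ → ∀ n, Code A Se Sd X Y Z R n → Prop := fun k n C => C.numMsg = M n ∧
    C.law W {ω | C.dec ω.2.2.1 ω.2.1.2.2 ≠ ω.1 ∨
      ((D + 1 / ((k : ℝ) + 1) : ℝ) : EReal) < C.distortion W ω} ≤ 2 * δ k
  have hne : ∀ n, Nonempty (Code A Se Sd X Y Z R n) := fun n => by
    obtain ⟨C, -⟩ := exists_code W p n (g n) one_pos (hT n) (hTt n) D one_ne_zero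
      ENNReal.one_ne_top one_pos one_pos
    exact ⟨C⟩
  have hev : ∀ k, ∀ᶠ n in atTop, ∃ C, Good k n C := by
    intro k
    have hdist := tendsto_measure_of_pLimsup_lt
      (hg.trans_lt (EReal.coe_lt_coe_iff.2
        (show D < D + 1 / ((k : ℝ) + 1) by simp; positivity)))
    have hlim := (((hcov.add (ENNReal.Tendsto.div_const (hTc.add hdist) (Or.inr (hδ k)))).add
      (tendsto_covering_term hcb)).add_const (δ k)).add
      (tendsto_packing_term (hc0.trans hcb.le) (by linarith : r + b < a))
    have hlt : 0 + (0 + 0) / δ k + 0 + δ k + 0 < 2 * δ k := by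
      simp only [add_zero, zero_add, ENNReal.zero_div, two_mul]
      exact ENNReal.lt_add_right (hδ' k) (hδ k)
    filter_upwards [hlim.eventually_lt_const hlt, eventually_gt_atTop 0] with n hn hn0
    obtain ⟨C, hCM, hC⟩ := exists_code W p n (g n) (Real.exp_pos (n * c)) (hT n) (hTt n)
      (D + 1 / ((k : ℝ) + 1)) (hδ k) (hδ' k) (Nat.ceil_pos.2 (Real.exp_pos (n * b))) (hM n)
    refine ⟨C, hCM, hC.trans (le_trans (le_of_eq ?_) hn.le)⟩
    simp only [lt_logRatioRate_iff hn0]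
    rfl
  obtain ⟨k, hk, hkQ⟩ := exists_tendsto_eventually_of_forall_eventually hev
  have hchoice : ∀ n, ∃ C, (∃ C, Good (k n) n C) → Good (k n) n C := fun n => by
    by_cases h : ∃ C, Good (k n) n C
    · exact h.imp fun C hC _ => hC
    · exact ⟨(hne n).some, fun h' => absurd h' h⟩
  choose C hC using hchoice
  have hgood : ∀ᶠ n in atTop, Good (k n) n (C n) := hkQ.mono fun n hn => hC n hn
  have hδk : Tendsto (fun n => 2 * δ (k n)) atTop (𝓝 0) := by
    have := ENNReal.Tendsto.const_mul (a := 2) (tendsto_ofReal_one_div_comp hk) (Or.inr (by simp))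
    rwa [mul_zero] at this
  intro ε hε
  refine ⟨C, ?_, ?_, ?_⟩
  · refine le_liminf_of_le (by isBoundedDefault) ?_
    filter_upwards [hgood, eventually_gt_atTop 0] with n hn hn0
    rw [EReal.coe_le_coe_iff, le_div_iff₀ (by exact_mod_cast hn0), hn.1, mul_comm,
      Real.le_log_iff_exp_le (by exact_mod_cast hM n)]
    exact Nat.le_ceil _
  · refine le_trans (le_of_eq (Tendsto.limsup_eq ?_)) (zero_le (a := ENNReal.ofReal ε))
    refine tendsto_of_tendsto_of_tendsto_of_le_of_le' tendsto_const_nhds hδk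
      (Eventually.of_forall fun _ => zero_le) ?_
    filter_upwards [hgood] with n hn
    exact (measure_mono fun ω hω => Or.inl hω).trans hn.2
  · refine pLimsup_le_of_forall fun α hα => ?_
    refine tendsto_of_tendsto_of_tendsto_of_le_of_le' tendsto_const_nhds hδk
      (Eventually.of_forall fun _ => zero_le) ?_
    have hsmall := (tendsto_one_div_add_atTop_nhds_zero_nat (𝕜 := ℝ)).comp hk
    filter_upwards [hgood, hsmall.eventually_lt_const (sub_pos.2 hα)] with n hn hn'
    refine (measure_mono fun ω hω => Or.inr (lt_trans ?_ hω)).trans hn.2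
    rw [EReal.coe_lt_coe_iff]
    simp only [Function.comp_apply] at hn'
    linarith

/-- Decoding sets for a spectral inf-mutual information rate. -/
lemma exists_decodingSets {V V' : ℕ → Type*} [∀ n, MeasurableSpace (V n)]
    [∀ n, MeasurableSpace (V' n)] (P : ∀ n, Measure (V n × V' n)) [∀ n, IsProbabilityMeasure (P n)]
    {a : ℝ} (ha : (a : EReal) < infMutualInfoRate P) :
    ∃ T : ∀ n, Set (V n × V' n), (∀ n, MeasurableSet (T n)) ∧
      (∀ n w, (P n).fst {v | (v, w) ∈ T n} ≤ ENNReal.ofReal (Real.exp (-(n * a)))) ∧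
      Tendsto (fun n => P n (T n)ᶜ) atTop (𝓝 0) := by
  have h := fun n : ℕ => exists_decodingSet (P n) (t := ENNReal.ofReal (Real.exp (n * a)))
    (ENNReal.ofReal_pos.2 (Real.exp_pos _)).ne' ENNReal.ofReal_ne_top
  choose T hT hTt hTc using h
  refine ⟨T, hT, fun n w => ?_, ?_⟩
  · rw [Real.exp_neg, ENNReal.ofReal_inv_of_pos (Real.exp_pos _)]
    exact hTt n w
  · refine tendsto_of_tendsto_of_tendsto_of_le_of_le' tendsto_const_nhds
      (tendsto_measure_of_lt_pLiminf ha) (Eventually.of_forall fun _ => zero_le) ?_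
    filter_upwards [eventually_gt_atTop 0] with n hn
    refine (hTc n).trans (measure_mono fun ω hω => ?_)
    exact (logRatioRate_lt_iff hn _ _ _ _).2 hω

/-- The form in which achievability enters: a process contributes `I₁ - I₂` if all rates below
`a - I₂` with `a < I₁` are achievable. -/
lemma sub_le_capacity (W : Model A Se S Sd X Y Z R) (D : ℝ) {I₁ I₂ : EReal}
    (h : ∀ a r : ℝ, (a : EReal) < I₁ → I₂ < ((a - r : ℝ) : EReal) → W.Achievable r D) :
    I₁ - I₂ ≤ W.capacity D := by
  refine le_of_forall_lt fun c hc => ?_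
  obtain ⟨r, hcr, hr⟩ := EReal.lt_iff_exists_real_btwn.1 hc
  obtain ⟨a, hra, ha⟩ := EReal.lt_iff_exists_real_btwn.1 (EReal.add_lt_of_lt_sub hr)
  refine hcr.trans_le (le_sSup ⟨r, h a r ha ?_, rfl⟩)
  rw [EReal.coe_sub, EReal.lt_sub_iff_add_lt (by simp) (by simp), add_comm]
  exact hra

section Capacity

variable [StandardBorelSpace A] [StandardBorelSpace Se] [StandardBorelSpace S]
  [StandardBorelSpace Sd] [StandardBorelSpace X] [Nonempty Se]
  (W : Model A Se S Sd X Y Z R) (D : ℝ)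

theorem supWithAction_le_capacity : W.supWithAction D ≤ W.capacity D := by
  refine sSup_le ?_
  rintro _ ⟨U, _, _, _, p, hp, rfl⟩
  refine sub_le_capacity W D fun a r ha hr => ?_
  have : ∀ n, IsProbabilityMeasure ((p.law W n).map
      (fun ω => ((ω.1.1.1.1, ω.1.1.2), (ω.2.1, ω.1.1.1.2.2.2)))) := fun n =>
    Measure.isProbabilityMeasure_map (by fun_prop)
  obtain ⟨T, hT, hTt, hTc⟩ := exists_decodingSets _ ha
  refine p.achievable W hp hT (fun n w => ?_) ?_ hr
  · have h := hTt n w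
    rw [Measure.fst, Measure.map_map (by fun_prop) (by fun_prop)] at h
    exact h
  · refine hTc.congr fun n => ?_
    rw [Measure.map_apply (by fun_prop) (hT n).compl]
    rfl

theorem supWithoutAction_le_capacity : W.supWithoutAction D ≤ W.capacity D := by
  refine sSup_le ?_
  rintro _ ⟨U, _, _, _, p, hp, rfl⟩
  refine sub_le_capacity W D fun a r ha hr => ?_
  have : ∀ n, IsProbabilityMeasure ((p.law W n).map
      (fun ω => (ω.1.1.2, (ω.2.1, ω.1.1.1.2.2.2)))) := fun n =>
    Measure.isProbabilityMeasure_map (by fun_prop)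
  obtain ⟨T, hT, hTt, hTc⟩ := exists_decodingSets _ ha
  -- The decoder may ignore the action.
  have hm : ∀ n, Measurable (fun z : ((Fin n → A) × (Fin n → U)) × ((Fin n → Y) × (Fin n → Sd)) =>
    (z.1.2, z.2)) := fun n => by fun_prop
  refine p.achievable W hp (fun n => hm n (hT n)) (fun n w => ?_) ?_ hr
  · have h := hTt n w
    have hTw : MeasurableSet {v | (v, w) ∈ T n} := measurable_prodMk_right (hT n)
    rw [Measure.fst, Measure.map_map (by fun_prop) (by fun_prop),
      Measure.map_apply (by fun_prop) hTw] at h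
    have hTw' : MeasurableSet {z : (Fin n → A) × (Fin n → U) |
        (z, w) ∈ (fun z => (z.1.2, z.2)) ⁻¹' T n} := measurable_prodMk_right (hm n (hT n))
    rw [Measure.map_apply (by fun_prop) hTw']
    exact h
  · refine hTc.congr fun n => ?_
    rw [Measure.map_apply (by fun_prop) (hT n).compl]
    rfl

end Capacity

end Achievability

/-! ### Converse -/

/-- One-shot converse: if `φ v` takes each value with probability at most `N⁻¹` and is decoded from
`w` with error probability at most `e`, then small likelihood ratios are unlikely. -/
lemma measure_likelihoodRatio_le_of_decoder {V W ι : Type*} [MeasurableSpace V] [MeasurableSpace W]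
    [MeasurableSpace ι] [Countable ι] [MeasurableSingletonClass ι]
    (P : Measure (V × W)) [IsProbabilityMeasure P] {φ : V → ι} (hφ : Measurable φ) {dec : W → ι}
    (hdec : Measurable dec) {N e : ℝ≥0∞} (hN : ∀ i, P.fst {v | dec i = φ v} ≤ N⁻¹)
    (he : P {ω | dec ω.2 ≠ φ ω.1} ≤ e) {t : ℝ≥0∞} (ht : t ≠ ∞) :
    P {ω | likelihoodRatio P (P.fst.prod P.snd) ω ≤ t} ≤ e + t * N⁻¹ := by
  have hS : MeasurableSet {ω : V × W | dec ω.2 = φ ω.1} :=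
    measurableSet_eq_fun (hdec.comp measurable_snd) (hφ.comp measurable_fst)
  calc P {ω | likelihoodRatio P (P.fst.prod P.snd) ω ≤ t}
      ≤ P ({ω | dec ω.2 ≠ φ ω.1} ∪ ({ω | dec ω.2 = φ ω.1} ∩
          {ω | likelihoodRatio P (P.fst.prod P.snd) ω ≤ t})) := by
        refine measure_mono fun ω hω => ?_
        by_cases h : dec ω.2 = φ ω.1
        · exact Or.inr ⟨h, hω⟩
        · exact Or.inl h
    _ ≤ e + t * (P.fst.prod P.snd) {ω | dec ω.2 = φ ω.1} :=
        (measure_union_le _ _).trans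
          (add_le_add he (measure_inter_likelihoodRatio_le P _ ht hS))
    _ ≤ e + t * N⁻¹ := by
        gcongr
        rw [Measure.prod_apply_symm hS]
        exact (lintegral_mono (g := fun _ => N⁻¹) fun w => hN w).trans_eq (by simp)

/-- If `u` and `s` are conditionally independent given `a`, the law of `(a, (u, s))` is its own
conditional product. -/
lemma condProduct_compProd_prod {α σ υ : Type*} [MeasurableSpace α] [MeasurableSpace σ]
    [MeasurableSpace υ] [StandardBorelSpace υ] [Nonempty υ] [StandardBorelSpace σ] [Nonempty σ]
    (μ : Measure α) [IsProbabilityMeasure μ] (η₁ : Kernel α υ) [IsMarkovKernel η₁]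
    (η₂ : Kernel α σ) [IsMarkovKernel η₂] (P : Measure (α × (υ × σ))) [IsProbabilityMeasure P]
    (hP : P = μ ⊗ₘ (η₁ ×ₖ η₂)) : condProduct P = P := by
  have hfst : P.fst = μ := by rw [hP, Measure.fst_compProd]
  rw [condProduct_eq P η₁ η₂, hfst, hP]
  · rw [hfst, hP, map_compProd_map _ _ measurable_fst, ← Kernel.fst_eq, Kernel.fst_prod]
  · rw [hfst, hP, map_compProd_map _ _ measurable_snd, ← Kernel.snd_eq, Kernel.snd_prod]

/-- A uniformly distributed index `m` of actions `a m` and encoders `f m`, with a label `u m` from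
which `m` can be recovered, gives rise to a joint law of the form `jointLaw` in which the label is
drawn given the action only. -/
lemma exists_jointLaw_eq_map {α σ τ υ χ ω : Type*} [MeasurableSpace α] [MeasurableSpace σ]
    [MeasurableSpace τ] [MeasurableSpace υ] [MeasurableSpace χ] [MeasurableSpace ω]
    [StandardBorelSpace υ] [Nonempty υ] (κ : Kernel α (σ × τ)) [IsMarkovKernel κ]
    (ch : Kernel (χ × τ) ω) [IsMarkovKernel ch] {N : ℕ} (hN : 0 < N) (a : Fin N → α)
    (f : Fin N → σ → χ) (hf : ∀ m, Measurable (f m)) (u : Fin N → υ) (φ : υ → Fin N)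
    (hφ : Measurable φ) (hφu : ∀ m, φ (u m) = m) :
    ∃ (μ : Measure α) (_ : IsProbabilityMeasure μ) (auxA : Kernel α υ) (_ : IsMarkovKernel auxA)
      (inp : Kernel (υ × σ) χ) (_ : IsMarkovKernel inp),
      jointLaw μ κ (Kernel.prodMkRight σ auxA) inp ch =
        ((N : ℝ≥0∞)⁻¹ • ∑ m, (Measure.dirac m).prod (wordLaw κ ch (a m) (f m) (hf m))).map
          (fun z => ((((a z.1, z.2.1), u z.1), f z.1 z.2.1.1), z.2.2)) := by
  let ν : Measure (α × υ) := (N : ℝ≥0∞)⁻¹ • ∑ m, Measure.dirac (a m, u m)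
  have hN0 : (N : ℝ≥0∞) ≠ 0 := by exact_mod_cast hN.ne'
  have : IsProbabilityMeasure ν := ⟨by
    simp [ν, ENNReal.inv_mul_cancel hN0 (ENNReal.natCast_ne_top N)]⟩
  have hν : ∀ F : α × υ → ℝ≥0∞, Measurable F →
      ∫⁻ z, F z ∂ν = (N : ℝ≥0∞)⁻¹ * ∑ m, F (a m, u m) := fun F hF => by
    rw [lintegral_smul_measure, lintegral_finsetSum_measure, smul_eq_mul]
    simp only [lintegral_dirac' _ hF]
  have hg : Measurable (fun z : υ × σ => f (φ z.1) z.2) := by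
    have h : Measurable (fun z : Fin N × σ => f z.1 z.2) :=
      measurable_from_prod_countable_right hf
    exact h.comp ((hφ.comp measurable_fst).prodMk measurable_snd)
  have hmap : Measurable (fun z : Fin N × ((σ × τ) × ω) =>
      ((((a z.1, z.2.1), u z.1), f z.1 z.2.1.1), z.2.2)) :=
    measurable_from_prod_countable_right fun m => by
      have := hf m
      exact (by fun_prop : Measurable fun y : (σ × τ) × ω =>
        ((((a m, y.1), u m), f m y.1.1), y.2))
  refine ⟨ν.fst, inferInstance, ν.condKernel, inferInstance, Kernel.deterministic _ hg,
    inferInstance, Measure.ext_of_lintegral _ fun F hF => ?_⟩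
  have hg' : Measurable (fun y : (α × (σ × τ)) × υ => f (φ y.2) y.1.2.1) :=
    hg.comp (by fun_prop : Measurable fun y : (α × (σ × τ)) × υ => (y.2, y.1.2.1))
  let G : (α × (σ × τ)) × υ → ℝ≥0∞ := fun y =>
    ∫⁻ o, F ((y, f (φ y.2) y.1.2.1), o) ∂ch (f (φ y.2) y.1.2.1, y.1.2.2)
  have hG : Measurable G :=
    Measurable.lintegral_kernel_prod_right'
      (κ := ch.comap (fun y : (α × (σ × τ)) × υ => (f (φ y.2) y.1.2.1, y.1.2.2))
        (hg'.prodMk measurable_fst.snd.snd))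
      (hF.comp ((measurable_fst.prodMk (hg'.comp measurable_fst)).prodMk measurable_snd))
  have hch : Measurable fun y : ((α × (σ × τ)) × υ) × χ =>
      ∫⁻ o, F (y, o) ∂ch (y.2, y.1.1.2.2) :=
    hF.lintegral_kernel_prod_right'
      (κ := ch.comap (fun y : ((α × (σ × τ)) × υ) × χ => (y.2, y.1.1.2.2)) (by fun_prop))
  have hκG : Measurable fun z : α × υ => ∫⁻ y, G ((z.1, y), z.2) ∂κ z.1 :=
    Measurable.lintegral_kernel_prod_right'
      (κ := κ.comap (fun z : α × υ => z.1) measurable_fst)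
      (hG.comp (by fun_prop : Measurable fun z : (α × υ) × (σ × τ) => ((z.1.1, z.2), z.1.2)))
  calc ∫⁻ z, F z ∂jointLaw ν.fst κ (Kernel.prodMkRight σ ν.condKernel)
        (Kernel.deterministic _ hg) ch
      = ∫⁻ b, ∫⁻ y, ∫⁻ w, G ((b, y), w) ∂ν.condKernel b ∂κ b ∂ν.fst := by
        rw [lintegral_jointLaw _ _ _ _ _ hF]
        refine lintegral_congr fun b => lintegral_congr fun y => lintegral_congr fun w => ?_
        exact Kernel.lintegral_deterministic' hg (f := fun x => ∫⁻ o, F ((((b, y), w), x), o)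
          ∂ch (x, y.2)) (hch.comp (measurable_prodMk_left (x := ((b, y), w))))
    _ = ∫⁻ b, ∫⁻ w, ∫⁻ y, G ((b, y), w) ∂κ b ∂ν.condKernel b ∂ν.fst := by
        refine lintegral_congr fun b => lintegral_lintegral_swap (Measurable.aemeasurable ?_)
        exact hG.comp (by fun_prop : Measurable fun z : (σ × τ) × υ => ((b, z.1), z.2))
    _ = (N : ℝ≥0∞)⁻¹ * ∑ m, ∫⁻ y, G ((a m, y), u m) ∂κ (a m) := by
        rw [← hν _ hκG]
        conv_rhs => rw [← ν.disintegrate ν.condKernel]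
        exact (Measure.lintegral_compProd hκG).symm
    _ = _ := by
        rw [lintegral_map hF hmap, lintegral_smul_measure, lintegral_finsetSum_measure, smul_eq_mul]
        congr 1
        refine Finset.sum_congr rfl fun m _ => ?_
        have hFm := hF.comp hmap
        have hFm' : Measurable fun y : (σ × τ) × ω =>
            F ((((a m, y.1), u m), f m y.1.1), y.2) := hFm.comp measurable_prodMk_left
        rw [Measure.dirac_prod, lintegral_map (by exact hFm) measurable_prodMk_left]
        unfold wordLaw
        rw [Measure.lintegral_compProd hFm']
        simp only [G, hφu]
        rfl

section Converse

variable {A Se S Sd X Y Z R : Type u}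
  [MeasurableSpace A] [MeasurableSpace Se] [MeasurableSpace S] [MeasurableSpace Sd]
  [MeasurableSpace X] [MeasurableSpace Y] [MeasurableSpace Z] [MeasurableSpace R]

instance (W : Model A Se S Sd X Y Z R) {n : ℕ} (C : Code A Se Sd X Y Z R n) :
    IsProbabilityMeasure (C.law W) := ⟨by
  have h0 : (C.numMsg : ℝ≥0∞) ≠ 0 := by exact_mod_cast C.numMsg_pos.ne'
  rw [C.law_apply W MeasurableSet.univ]
  simp [ENNReal.inv_mul_cancel h0 (ENNReal.natCast_ne_top _)]⟩

lemma Code.law_message_eq (W : Model A Se S Sd X Y Z R) {n : ℕ} (C : Code A Se Sd X Y Z R n)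
    (i : Fin C.numMsg) : C.law W {ω | ω.1 = i} = (C.numMsg : ℝ≥0∞)⁻¹ := by
  rw [C.law_apply W (measurableSet_eq_fun measurable_fst measurable_const)]
  rw [Finset.sum_eq_single i]
  · simp
  · intro m _ hm
    simp [hm]
  · simp

/-- The one-shot converse for a code, for any random variable `ψ M` from which the message `M` can
be recovered. -/
lemma Code.measure_likelihoodRatio_le (W : Model A Se S Sd X Y Z R) {n : ℕ}
    (C : Code A Se Sd X Y Z R n) {V : Type*} [MeasurableSpace V] (ψ : Fin C.numMsg → V)
    {φ : V → Fin C.numMsg} (hφ : Measurable φ) (hφψ : ∀ m, φ (ψ m) = m)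
    {P : Measure (V × ((Fin n → Y) × (Fin n → Sd)))}
    (hP : P = (C.law W).map (fun ω => (ψ ω.1, (ω.2.2.1, ω.2.1.2.2)))) {t : ℝ≥0∞} (ht : t ≠ ∞) :
    P {ω | likelihoodRatio P (P.fst.prod P.snd) ω ≤ t} ≤
      C.errorProb W + t * (C.numMsg : ℝ≥0∞)⁻¹ := by
  have hm : Measurable (fun ω : Fin C.numMsg × (((Fin n → Se) × (Fin n → S) × (Fin n → Sd)) ×
      ((Fin n → Y) × (Fin n → Z))) => (ψ ω.1, (ω.2.2.1, ω.2.1.2.2))) := by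
    have hψ : Measurable ψ := measurable_of_countable ψ
    fun_prop
  have : IsProbabilityMeasure P := by
    rw [hP]; exact Measure.isProbabilityMeasure_map hm.aemeasurable
  refine measure_likelihoodRatio_le_of_decoder P hφ C.measurable_dec (fun i => ?_)
    (le_of_eq ?_) ht
  · have hS : MeasurableSet {v | C.dec i.1 i.2 = φ v} := measurableSet_eq_fun measurable_const hφ
    rw [Measure.fst_apply hS, hP, Measure.map_apply hm (measurable_fst hS),
      ← C.law_message_eq W (C.dec i.1 i.2)]
    refine measure_mono fun ω hω => ?_
    have : C.dec i.1 i.2 = φ (ψ ω.1) := hω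
    rw [hφψ] at this
    exact this.symm
  · have hS : MeasurableSet {ω : V × ((Fin n → Y) × (Fin n → Sd)) | C.dec ω.2.1 ω.2.2 ≠ φ ω.1} :=
      (measurableSet_eq_fun (C.measurable_dec.comp measurable_snd)
        (hφ.comp measurable_fst)).compl
    rw [hP, Measure.map_apply hm hS]
    refine congrArg (C.law W) (Set.ext fun ω => ?_)
    change C.dec ω.2.2.1 ω.2.1.2.2 ≠ φ (ψ ω.1) ↔ C.dec ω.2.2.1 ω.2.1.2.2 ≠ ω.1
    rw [hφψ]

/-- A sequence of codes whose error probability vanishes, extracted diagonally from code sequences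
with arbitrarily small asymptotic error probability. -/
lemma Model.Achievable.exists_codes {W : Model A Se S Sd X Y Z R} {r D : ℝ}
    (h : W.Achievable r D) :
    ∃ C : ∀ n, Code A Se Sd X Y Z R n,
      Tendsto (fun n => (C n).errorProb W) atTop (𝓝 0) ∧
      (∀ s < r, ∀ᶠ n : ℕ in atTop, s ≤ Real.log (C n).numMsg / n) ∧
      (∀ α : ℝ, D < α → Tendsto (fun n => (C n).law W {ω | (α : EReal) < (C n).distortion W ω})
        atTop (𝓝 0)) := by
  have hpos : ∀ k : ℕ, 0 < 1 / ((k : ℝ) + 1) := fun k => by positivity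
  choose C hrate herr hdist using fun k : ℕ => h (1 / ((k : ℝ) + 1)) (hpos k)
  let Q : ℕ → ℕ → Prop := fun k n =>
    (C k n).errorProb W ≤ 2 * ENNReal.ofReal (1 / ((k : ℝ) + 1)) ∧
    r - 1 / ((k : ℝ) + 1) ≤ Real.log (C k n).numMsg / n ∧
    (C k n).law W {ω | ((D + 1 / ((k : ℝ) + 1) : ℝ) : EReal) < (C k n).distortion W ω} ≤
      ENNReal.ofReal (1 / ((k : ℝ) + 1))
  have hQ : ∀ k, ∀ᶠ n in atTop, Q k n := fun k => by
    have hk : ENNReal.ofReal (1 / ((k : ℝ) + 1)) ≠ 0 := (ENNReal.ofReal_pos.2 (hpos k)).ne'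
    have h1 := eventually_lt_of_limsup_lt ((herr k).trans_lt
      (show _ < 2 * ENNReal.ofReal (1 / ((k : ℝ) + 1)) by
        rw [two_mul]; exact ENNReal.lt_add_right ENNReal.ofReal_ne_top hk))
    have h2 := eventually_lt_of_lt_liminf ((EReal.coe_lt_coe_iff.2
      (sub_lt_self r (hpos k))).trans_le (hrate k))
    have h3 := (tendsto_measure_of_pLimsup_lt ((hdist k).trans_lt (EReal.coe_lt_coe_iff.2
      (lt_add_of_pos_right D (hpos k))))).eventually_lt_const (pos_iff_ne_zero.2 hk)
    filter_upwards [h1, h2, h3] with n h1 h2 h3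
    exact ⟨h1.le, (EReal.coe_lt_coe_iff.1 h2).le, h3.le⟩
  obtain ⟨k, hk, hkQ⟩ := exists_tendsto_eventually_of_forall_eventually hQ
  have hδ := tendsto_ofReal_one_div_comp hk
  have hsmall := (tendsto_one_div_add_atTop_nhds_zero_nat (𝕜 := ℝ)).comp hk
  refine ⟨fun n => C (k n) n, ?_, fun s hs => ?_, fun α hα => ?_⟩
  · have h2δ := ENNReal.Tendsto.const_mul (a := 2) hδ (Or.inr (by simp))
    rw [mul_zero] at h2δ
    exact tendsto_of_tendsto_of_tendsto_of_le_of_le' tendsto_const_nhds h2δ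
      (Eventually.of_forall fun _ => zero_le) (hkQ.mono fun n hn => hn.1)
  · filter_upwards [hkQ, hsmall.eventually_lt_const (sub_pos.2 hs)] with n hn hn'
    simp only [Function.comp_apply] at hn'
    linarith [hn.2.1]
  · refine tendsto_of_tendsto_of_tendsto_of_le_of_le' tendsto_const_nhds hδ
      (Eventually.of_forall fun _ => zero_le) ?_
    filter_upwards [hkQ, hsmall.eventually_lt_const (sub_pos.2 hα)] with n hn hn'
    refine le_trans (measure_mono fun ω hω => ?_) hn.2.2
    refine lt_trans ?_ (show (α : EReal) < (C (k n) n).distortion W ω from hω)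
    rw [EReal.coe_lt_coe_iff]
    simp only [Function.comp_apply] at hn'
    linarith

/-- The factors of a process that describes a code: the auxiliary word of positive length is a
repetition of the message, so that the message can be recovered from it, and it is drawn given the
action only. -/
lemma Code.exists_factors [Nonempty Se] (W : Model A Se S Sd X Y Z R) {n : ℕ}
    (C : Code A Se Sd X Y Z R n) :
    ∃ (μ : Measure (Fin n → A)) (_ : IsProbabilityMeasure μ)
      (auxA : Kernel (Fin n → A) (Fin n → ULift.{u} ℕ)) (_ : IsMarkovKernel auxA)
      (inp : Kernel ((Fin n → ULift.{u} ℕ) × (Fin n → Se)) (Fin n → X)) (_ : IsMarkovKernel inp),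
      0 < n → ∃ (v : Fin C.numMsg → Fin n → ULift.{u} ℕ)
        (φ : (Fin n → ULift.{u} ℕ) → Fin C.numMsg), Measurable φ ∧ (∀ m, φ (v m) = m) ∧
        jointLaw μ (W.state n) (Kernel.prodMkRight _ auxA) inp (W.extChannel n) =
          (C.law W).map (fun z =>
            ((((C.actionEnc z.1, z.2.1), v z.1), C.enc z.1 z.2.1.1), z.2.2)) := by
  let m₀ : Fin C.numMsg := ⟨0, C.numMsg_pos⟩
  rcases Nat.eq_zero_or_pos n with hn | hn
  · exact ⟨Measure.dirac (C.actionEnc m₀), inferInstance,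
      Kernel.const _ (Measure.dirac fun _ => ⟨0⟩), inferInstance,
      Kernel.const _ (Measure.dirac (C.enc m₀ (Classical.arbitrary _))), inferInstance,
      fun h => absurd hn h.ne'⟩
  · let φ : (Fin n → ULift.{u} ℕ) → Fin C.numMsg := fun w =>
      if h : (w ⟨0, hn⟩).down < C.numMsg then ⟨(w ⟨0, hn⟩).down, h⟩ else m₀
    have hφ : Measurable φ := measurable_of_countable φ
    have hφv : ∀ m : Fin C.numMsg, φ (fun _ => ⟨m.1⟩) = m := fun m => by simp [φ]
    obtain ⟨μ, hμ, auxA, hauxA, inp, hinp, h⟩ := exists_jointLaw_eq_map (W.state n)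
      (W.extChannel n) C.numMsg_pos C.actionEnc C.enc C.measurable_enc (fun m _ => ⟨m.1⟩) φ hφ hφv
    exact ⟨μ, hμ, auxA, hauxA, inp, hinp, fun _ => ⟨fun m _ => ⟨m.1⟩, φ, hφ, hφv, h⟩⟩

/-- The spectral inf-mutual information rate is at least the rate of a code with vanishing error
probability, if its first argument determines the message. -/
lemma le_infMutualInfoRate_of_codes (W : Model A Se S Sd X Y Z R)
    (C : ∀ n, Code A Se Sd X Y Z R n)
    (herr : Tendsto (fun n => (C n).errorProb W) atTop (𝓝 0)) {r : ℝ}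
    (hrate : ∀ s < r, ∀ᶠ n : ℕ in atTop, s ≤ Real.log (C n).numMsg / n)
    {V : ℕ → Type*} [∀ n, MeasurableSpace (V n)]
    {P : ∀ n, Measure (V n × ((Fin n → Y) × (Fin n → Sd)))}
    (hP : ∀ n, 0 < n → ∃ (ψ : Fin (C n).numMsg → V n) (φ : V n → Fin (C n).numMsg),
      Measurable φ ∧ (∀ m, φ (ψ m) = m) ∧
      P n = ((C n).law W).map (fun ω => (ψ ω.1, (ω.2.2.1, ω.2.1.2.2)))) :
    (r : EReal) ≤ infMutualInfoRate P := by
  refine le_pLiminf_of_forall fun β hβ => ?_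
  have hs : (β + r) / 2 < r := by linarith
  have hlim := herr.add (tendsto_exp_nat_mul_atTop_nhds_zero
    (show β - (β + r) / 2 < 0 by linarith))
  rw [add_zero] at hlim
  refine tendsto_of_tendsto_of_tendsto_of_le_of_le' tendsto_const_nhds hlim
    (Eventually.of_forall fun _ => zero_le) ?_
  filter_upwards [hrate _ hs, eventually_gt_atTop 0] with n hn hn0
  obtain ⟨ψ, φ, hφ, hφψ, hPn⟩ := hP n hn0
  have hNpos : (0 : ℝ) < (C n).numMsg := by exact_mod_cast (C n).numMsg_pos
  calc P n {ω | logRatioRate n (P n) ((P n).fst.prod (P n).snd) ω < β}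
      ≤ P n {ω | likelihoodRatio (P n) ((P n).fst.prod (P n).snd) ω ≤
          ENNReal.ofReal (Real.exp (n * β))} :=
        measure_mono fun ω hω => ((logRatioRate_lt_iff hn0 _ _ _ _).1 hω).le
    _ ≤ (C n).errorProb W + ENNReal.ofReal (Real.exp (n * β)) * ((C n).numMsg : ℝ≥0∞)⁻¹ :=
        (C n).measure_likelihoodRatio_le W ψ hφ hφψ hPn ENNReal.ofReal_ne_top
    _ ≤ _ := by
        gcongr
        rw [← ENNReal.ofReal_natCast, ← ENNReal.ofReal_inv_of_pos hNpos,
          ← ENNReal.ofReal_mul (Real.exp_pos _).le]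
        apply ENNReal.ofReal_le_ofReal
        rw [mul_sub, Real.exp_sub, div_eq_mul_inv]
        gcongr
        rwa [le_div_iff₀ (by exact_mod_cast hn0), mul_comm, Real.le_log_iff_exp_le hNpos] at hn

/-- Converse: an achievable rate is attained by a process with `I(U; Se | A) ≤ 0`. -/
theorem Model.Achievable.exists_process [StandardBorelSpace Se] [Nonempty Se]
    {W : Model A Se S Sd X Y Z R} {r D : ℝ} (h : W.Achievable r D) :
    ∃ p : GenProcess A Se X (ULift.{u} ℕ), p.MeetsDistortion W D ∧
      (r : EReal) ≤ p.infInfoAU W ∧ (r : EReal) ≤ p.infInfoU W ∧ p.supInfoCond W ≤ 0 := by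
  obtain ⟨C, herr, hrate, hdist⟩ := h.exists_codes
  choose μ hμ auxA hauxA inp hinp hC using fun n => (C n).exists_factors W
  let p : GenProcess A Se X (ULift.{u} ℕ) :=
    { action := μ
      action_prob := hμ
      aux := fun n => Kernel.prodMkRight _ (auxA n)
      aux_markov := fun n => inferInstance
      input := inp
      input_markov := hinp }
  have hlaw : ∀ n, p.law W n = jointLaw (μ n) (W.state n) (Kernel.prodMkRight _ (auxA n)) (inp n)
    (W.extChannel n) := fun n => rfl
  have hmeas : ∀ n (v : Fin (C n).numMsg → Fin n → ULift.{u} ℕ), Measurable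
      (fun z : Fin (C n).numMsg × (((Fin n → Se) × (Fin n → S) × (Fin n → Sd)) ×
        ((Fin n → Y) × (Fin n → Z))) =>
        (((((C n).actionEnc z.1, z.2.1), v z.1), (C n).enc z.1 z.2.1.1), z.2.2)) := fun n v =>
    measurable_from_prod_countable_right fun m => by
      have := (C n).measurable_enc m
      exact (by fun_prop : Measurable fun y : ((Fin n → Se) × (Fin n → S) × (Fin n → Sd)) ×
        ((Fin n → Y) × (Fin n → Z)) =>
          (((((C n).actionEnc m, y.1), v m), (C n).enc m y.1.1), y.2))
  refine ⟨p, ⟨fun n => (C n).est, ?_⟩, ?_, ?_, ?_⟩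
  · refine pLimsup_le_of_forall fun α hα => (hdist α hα).congr' ?_
    filter_upwards [eventually_gt_atTop 0] with n hn
    obtain ⟨v, φ, hφ, hφv, hjl⟩ := hC n hn
    have hd := (measurable_distortion_aux W (C n).est).comp (by fun_prop : Measurable
      fun ω : ((((Fin n → A) × ((Fin n → Se) × (Fin n → S) × (Fin n → Sd))) ×
        (Fin n → ULift.{u} ℕ)) × (Fin n → X)) × ((Fin n → Y) × (Fin n → Z)) =>
        (ω.1.1.1.2.2.1, ω.1.2, ω.1.1.1.1, ω.1.1.1.2.1, ω.2.2))
    rw [hlaw, hjl]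
    exact (Measure.map_apply (hmeas n v) (measurableSet_lt measurable_const hd)).symm
  · refine le_infMutualInfoRate_of_codes W C herr hrate fun n hn => ?_
    obtain ⟨v, φ, hφ, hφv, hjl⟩ := hC n hn
    refine ⟨fun m => ((C n).actionEnc m, v m), fun w => φ w.2, hφ.comp measurable_snd, hφv, ?_⟩
    rw [hlaw, hjl, Measure.map_map (by fun_prop) (hmeas n v)]
    rfl
  · refine le_infMutualInfoRate_of_codes W C herr hrate fun n hn => ?_
    obtain ⟨v, φ, hφ, hφv, hjl⟩ := hC n hn
    refine ⟨v, φ, hφ, hφv, ?_⟩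
    rw [hlaw, hjl, Measure.map_map (by fun_prop) (hmeas n v)]
    rfl
  · refine pLimsup_le_of_forall (D := 0) fun α hα => ?_
    refine tendsto_const_nhds.congr' ?_
    filter_upwards [eventually_gt_atTop 0] with n hn
    set P := (p.law W n).map (fun ω => (ω.1.1.1.1, (ω.1.1.2, ω.1.1.1.2.1)))
    have : IsProbabilityMeasure P := Measure.isProbabilityMeasure_map (by fun_prop)
    have hP : P = μ n ⊗ₘ (auxA n ×ₖ (W.state n).fst) := by
      rw [compProd_prod_eq_map, ← jointLaw_map (μ n) (W.state n) (Kernel.prodMkRight _ (auxA n))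
        (inp n) (W.extChannel n), Measure.map_map (by fun_prop) (by fun_prop)]
      rfl
    have hcP := condProduct_compProd_prod _ _ _ P hP
    have h0 : P {z | ¬ likelihoodRatio P P z = 1} = 0 := ae_iff.1 (likelihoodRatio_self P)
    refine (measure_mono_null (fun z hz => ?_) h0).symm
    have hz' : (α : EReal) < logRatioRate n P (condProduct P) z := hz
    rw [hcP, lt_logRatioRate_iff hn] at hz'
    intro h1
    rw [h1, ENNReal.ofReal_lt_one] at hz'
    exact absurd hz' (not_lt.2 (Real.one_le_exp (by positivity)))

variable [StandardBorelSpace Se] [Nonempty Se] (W : Model A Se S Sd X Y Z R) (D : ℝ)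

theorem capacity_le_supWithAction : W.capacity D ≤ W.supWithAction D := by
  refine sSup_le ?_
  rintro _ ⟨r, hr, rfl⟩
  obtain ⟨p, hp, hAU, -, hI⟩ := hr.exists_process
  refine le_trans ?_ (le_sSup
    ⟨ULift.{u} ℕ, inferInstance, inferInstance, inferInstance, p, hp, rfl⟩)
  simpa using EReal.sub_le_sub hAU hI

theorem capacity_le_supWithoutAction : W.capacity D ≤ W.supWithoutAction D := by
  refine sSup_le ?_
  rintro _ ⟨r, hr, rfl⟩
  obtain ⟨p, hp, -, hU, hI⟩ := hr.exists_process
  refine le_trans ?_ (le_sSup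
    ⟨ULift.{u} ℕ, inferInstance, inferInstance, inferInstance, p, hp, rfl⟩)
  simpa using EReal.sub_le_sub hU hI

end Converse

end ISAC

end

theorem theorem2 {A Se S Sd X Y Z R : Type u}
    [MeasurableSpace A] [MeasurableSpace Se] [MeasurableSpace S] [MeasurableSpace Sd]
    [MeasurableSpace X] [MeasurableSpace Y] [MeasurableSpace Z] [MeasurableSpace R]
    [StandardBorelSpace A] [StandardBorelSpace Se] [StandardBorelSpace S]
    [StandardBorelSpace Sd] [StandardBorelSpace X] [Nonempty Se]
    (W : ISAC.Model A Se S Sd X Y Z R) (D : ℝ) :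
    W.capacity D = W.supWithAction D ∧ W.capacity D = W.supWithoutAction D :=
  ⟨(ISAC.capacity_le_supWithAction W D).antisymm (ISAC.supWithAction_le_capacity W D),
    (ISAC.capacity_le_supWithoutAction W D).antisymm (ISAC.supWithoutAction_le_capacity W D)⟩
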